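/- Let $(\Omega,\mathcal F,\mathbb F=(\mathcal F_t)_{t\ge0},\mathbb P)$ be a filtered probability space satisfying the usual conditions and supporting an infinite sequence $W^1,W^2,\ldots$ of independent $\mathbb F$-Brownian motions, and let $b\in\mathbb R$. For $n\ge1$ let $\mathcal A_n$ be the set of $\mathbb F$-progressively measurable processes $\Phi=(\phi^1_t,\ldots,\phi^n_t)_{t\ge0}$ with values in $[0,1]^n$ and $\sum_{j=1}^n\phi^j_t\le1$ for all $t\ge0$. For $\Phi\in\mathcal A_n$ and $x\in\mathbb R_+^n$ (where $\mathbb R_+=[0,\infty)$) put, for $j=1,\ldots,n$, $$X^{j}_t=x_j+\int_0^t(b+\phi^j_s)\,\mathrm ds+W^j_t,\qquad \tau_j=\inf\{t\ge0:\ X^{j}_t\le0\}\quad(\inf\emptyset=\infty),$$ and define $$V^n(x)=\sup_{\Phi\in\mathcal A_n}\mathbb E\Big[\prod_{j=1}^n\mathbf 1_{\{\tau_j=\infty\}}\Big],\qquad U^n(x)=\sup_{\Phi\in\mathcal A_n}\mathbb E\Big[\sum_{j=1}^n\mathbf 1_{\{\tau_j=\infty\}}\Big].$$ Let $n\ge2$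 and $i\in\{1,\ldots,n\}$. For $x^{-i}=(x_1,\ldots,x_{i-1},x_{i+1},\ldots,x_n)\in\mathbb R_+^{n-1}$ and $z\ge 0$ write $(x^{-i},z)=(x_1,\ldots,x_{i-1},z,x_{i+1},\ldots,x_n)\in\mathbb R_+^{n}$. Then for every $x^{-i}\in\mathbb R_+^{n-1}$: 1. if $b\ge0$ or $b\le-\frac1{n-1}$, then $\lim_{z\to\infty}V^n(x^{-i},z)$ exists and equals $V^{n-1}(x^{-i})$; 2. if $b\ge0$, then $\lim_{z\to\infty}U^n(x^{-i},z)$ exists and equals $U^{n-1}(x^{-i})+1$. -/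

import Mathlib

open MeasureTheory ProbabilityTheory Filter Topology
open scoped NNReal

/-- A filtered probability space satisfying the usual conditions and carrying an infinite
sequence of independent Brownian motions relative to the filtration `𝓕`. -/
structure IsBrownianBasis {Ω : Type*} {mΩ : MeasurableSpace Ω}
    (𝓕 : Filtration ℝ≥0 mΩ) (W : ℕ → ℝ≥0 → Ω → ℝ) (P : Measure Ω) : Prop where
  /-- The filtration is right-continuous. -/
  rightContinuous : 𝓕.IsRightContinuous
  /-- The filtration is complete: every `P`-null set belongs to `𝓕 0`
  (`P` of an arbitrary set is its outer measure). -/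
  complete : ∀ A : Set Ω, P A = 0 → MeasurableSet[𝓕 0] A
  /-- Each `W j` is a standard Brownian motion started from `0`. -/
  brownian : ∀ j, IsBrownianReal (W j) P
  /-- The Brownian motions are mutually independent. -/
  indep : iIndepFun (fun j ω (t : ℝ≥0) ↦ W j t ω) P
  /-- Each `W j` is adapted to `𝓕`. -/
  adapted : ∀ j, Adapted 𝓕 (W j)
  /-- The future increments of the sequence after time `s` are independent of `𝓕 s`. -/
  indep_increments : ∀ s : ℝ≥0,
    Indep (MeasurableSpace.comap
      (fun ω (p : ℕ × ℝ≥0) ↦ W p.1 (s + p.2) ω - W p.1 s ω) inferInstance) (𝓕 s) P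

/-- The admissible controls for `n` agents: progressively measurable processes with values in
`[0,1]^n` whose components have sum at most `1` at all times. -/
structure IsAdmissible {Ω : Type*} {mΩ : MeasurableSpace Ω}
    (𝓕 : Filtration ℝ≥0 mΩ) {n : ℕ} (Φ : ℝ≥0 → Ω → Fin n → ℝ) : Prop where
  progressive : IsProgressive 𝓕 Φ
  mem_Icc : ∀ t ω j, Φ t ω j ∈ Set.Icc (0 : ℝ) 1
  sum_le_one : ∀ t ω, ∑ j, Φ t ω j ≤ 1

/-- The `j`-th coordinate of the controlled process started from `x`, that is
`X_t = x_j + ∫₀ᵗ (b + φ_s^j) ds + W_t^j`. For `n` agents, the first `n` Brownian motions of the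
sequence are used. -/
noncomputable def controlledProcess {Ω : Type*} (W : ℕ → ℝ≥0 → Ω → ℝ) (b : ℝ) {n : ℕ}
    (Φ : ℝ≥0 → Ω → Fin n → ℝ) (x : Fin n → ℝ) (j : Fin n) (t : ℝ≥0) (ω : Ω) : ℝ :=
  x j + (∫ s in (0 : ℝ)..t, (b + Φ s.toNNReal ω j)) + W j t ω

/-- The ruin time `inf {t ≥ 0 : X_t^j ≤ 0}` of the `j`-th coordinate, equal to `⊤` if the
coordinate never reaches `(-∞, 0]`. -/
noncomputable def ruinTime {Ω : Type*} (W : ℕ → ℝ≥0 → Ω → ℝ) (b : ℝ) {n : ℕ}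
    (Φ : ℝ≥0 → Ω → Fin n → ℝ) (x : Fin n → ℝ) (j : Fin n) : Ω → WithTop ℝ≥0 :=
  hittingAfter (controlledProcess W b Φ x j) (Set.Iic 0) 0

/-- The indicator of the event that the `j`-th coordinate survives forever. -/
noncomputable def survival {Ω : Type*} (W : ℕ → ℝ≥0 → Ω → ℝ) (b : ℝ) {n : ℕ}
    (Φ : ℝ≥0 → Ω → Fin n → ℝ) (x : Fin n → ℝ) (j : Fin n) : Ω → ℝ :=
  Set.indicator {ω | ruinTime W b Φ x j ω = ⊤} 1

/-- The all-survive value function `V^n`: the supremum over admissible controls of the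
probability that all coordinates survive forever. -/
noncomputable def valueV {Ω : Type*} {mΩ : MeasurableSpace Ω} (𝓕 : Filtration ℝ≥0 mΩ)
    (W : ℕ → ℝ≥0 → Ω → ℝ) (P : Measure Ω) (b : ℝ) (n : ℕ) (x : Fin n → ℝ) : ℝ :=
  ⨆ Φ : {Φ : ℝ≥0 → Ω → Fin n → ℝ // IsAdmissible 𝓕 Φ},
    ∫ ω, ∏ j, survival W b Φ.1 x j ω ∂P

/-- The count-survivors value function `U^n`: the supremum over admissible controls of the
expected number of coordinates that survive forever. -/
noncomputable def valueU {Ω : Type*} {mΩ : MeasurableSpace Ω} (𝓕 : Filtration ℝ≥0 mΩ)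
    (W : ℕ → ℝ≥0 → Ω → ℝ) (P : Measure Ω) (b : ℝ) (n : ℕ) (x : Fin n → ℝ) : ℝ :=
  ⨆ Φ : {Φ : ℝ≥0 → Ω → Fin n → ℝ // IsAdmissible 𝓕 Φ},
    ∫ ω, ∑ j, survival W b Φ.1 x j ω ∂P

/-! ### Controlled paths: accumulated drift, continuity, measurability of survival. -/

section Basic

variable {Ω : Type*} {mΩ : MeasurableSpace Ω} {P : Measure Ω} {𝓕 : Filtration ℝ≥0 mΩ}
  {W : ℕ → ℝ≥0 → Ω → ℝ} {b : ℝ} {n : ℕ} {Φ : ℝ≥0 → Ω → Fin n → ℝ} {x : Fin n → ℝ} {j : Fin n}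

/-! Both value functions are treated at once, through a payoff that is a function of the survival
indicators and loses at most one per lost agent (`IsSurvivalPayoff`).

Suppose `b ≥ 0`. Upper bound: pretend that the distant agent never dies and discard its share of the
drift. What remains is an admissible control of the other agents, but driven by the Brownian motions
that skip index `i`, whereas the smaller value function uses the first ones. Lower bound: take a
nearly optimal control of the smaller problem and save some drift for the new agent, at almost no
cost to the others. Both bounds rest on `IsAdmissible.exists_integral_survival_le`: any control can
be imitated, up to `ε`, on any other Brownian basis of the same filtration, by a control giving each
agent the constant `1 / (m + 1)` after some time `T`. The shares then add up to `m / (m + 1)`, which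
leaves exactly `1 / (m + 1)` for the new agent after `T`; started far enough away, it survives the
wait with probability close to one.

The imitation works as follows. A coordinate cannot survive and linger below a fixed level
(`eventually_real_survive_and_lt`), so survivors are high at a late time `T`, and from there a small
positive drift suffices (`real_exists_add_increment_nonpos_le`). Up to `T`, the control is replaced
by one with finitely many values on a time grid (`exists_gridControl`). For such controls,
maximising the conditional expected payoff one decision at a time yields decisions that depend only
on earlier decisions and on the driving paths (`exists_adapted_lintegral_le`). Since all bases have
the same law, that recipe can be run on the other basis, and information beyond the paths gives no
advantage.

If `b ≤ -1/m`, the total drift is nonpositive with `m` agents and with `m + 1`. Joint survival has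
probability zero in both cases (`real_forall_pos_eq_zero`), so both sides vanish. -/

theorem ruinTime_eq_top_iff {ω : Ω} :
    ruinTime W b Φ x j ω = ⊤ ↔ ∀ t, 0 < controlledProcess W b Φ x j t ω := by
  simp [ruinTime, hittingAfter_eq_top_iff]

theorem survival_eq_one_iff {ω : Ω} :
    survival W b Φ x j ω = 1 ↔ ∀ t, 0 < controlledProcess W b Φ x j t ω := by
  rw [← ruinTime_eq_top_iff]
  by_cases h : ruinTime W b Φ x j ω = ⊤ <;> simp [survival, Set.indicator, h]

theorem survival_eq_zero_or_one (ω : Ω) :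
    survival W b Φ x j ω = 0 ∨ survival W b Φ x j ω = 1 := by
  by_cases h : ruinTime W b Φ x j ω = ⊤ <;> simp [survival, Set.indicator, h]

namespace IsAdmissible

theorem measurable_time (h : IsAdmissible 𝓕 Φ) (ω : Ω) (j : Fin n) :
    Measurable fun t ↦ Φ t ω j := by
  -- Progressive measurability only speaks of bounded time intervals, so time is frozen at `N` and
  -- then `N → ∞`.
  have key : ∀ N : ℕ, Measurable fun t : ℝ≥0 ↦ Φ (min t N) ω j := by
    intro N
    have h1 := h.progressive (N : ℝ≥0)
    have h2 : Measurable[inferInstance, Subtype.instMeasurableSpace.prod (𝓕 (N : ℝ≥0))]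
        (fun t : ℝ≥0 ↦ ((⟨min t N, Set.mem_Iic.2 (min_le_right _ _)⟩ : Set.Iic (N : ℝ≥0)), ω)) :=
      Measurable.prodMk (Measurable.subtype_mk (measurable_id.min measurable_const))
        measurable_const
    exact (measurable_pi_apply j).comp (h1.comp h2)
  refine measurable_of_tendsto_metrizable key ?_
  rw [tendsto_pi_nhds]
  intro t
  refine tendsto_const_nhds.congr' ?_
  obtain ⟨N, hN⟩ := exists_nat_ge t
  filter_upwards [eventually_ge_atTop N] with k hk
  rw [min_eq_left (hN.trans (by exact_mod_cast hk))]

theorem measurable_toNNReal (h : IsAdmissible 𝓕 Φ) (ω : Ω) (j : Fin n) :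
    Measurable fun s : ℝ ↦ Φ s.toNNReal ω j :=
  (h.measurable_time ω j).comp measurable_real_toNNReal

theorem intervalIntegrable (h : IsAdmissible 𝓕 Φ) (ω : Ω) (j : Fin n) (s t : ℝ) :
    IntervalIntegrable (fun s : ℝ ↦ Φ s.toNNReal ω j) volume s t := by
  refine (intervalIntegrable_const (c := (1 : ℝ))).mono_fun
    (h.measurable_toNNReal ω j).aestronglyMeasurable (ae_of_all _ fun r ↦ ?_)
  have := h.mem_Icc r.toNNReal ω j
  simp only [Real.norm_eq_abs, abs_one]
  rw [abs_of_nonneg this.1]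
  exact this.2

end IsAdmissible

/-- The cumulative drift `∫₀ᵗ φ_s^j ds` allocated to agent `j` up to time `t`. -/
noncomputable def cumulative (Φ : ℝ≥0 → Ω → Fin n → ℝ) (j : Fin n) (t : ℝ≥0) (ω : Ω) : ℝ :=
  ∫ s in (0 : ℝ)..t, Φ s.toNNReal ω j

theorem cumulative_zero (ω : Ω) : cumulative Φ j 0 ω = 0 := by simp [cumulative]

namespace IsAdmissible

theorem controlledProcess_eq (h : IsAdmissible 𝓕 Φ) (t : ℝ≥0) (ω : Ω) :
    controlledProcess W b Φ x j t ω = x j + b * t + cumulative Φ j t ω + W j t ω := by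
  simp only [controlledProcess, cumulative]
  rw [intervalIntegral.integral_add (by simp) (h.intervalIntegrable ω j _ _)]
  simp
  ring

theorem cumulative_sub (h : IsAdmissible 𝓕 Φ) (s t : ℝ≥0) (ω : Ω) :
    cumulative Φ j t ω - cumulative Φ j s ω = ∫ r in (s : ℝ)..t, Φ r.toNNReal ω j := by
  rw [cumulative, cumulative, intervalIntegral.integral_interval_sub_left]
  · exact h.intervalIntegrable ω j _ _
  · exact h.intervalIntegrable ω j _ _

theorem cumulative_mono (h : IsAdmissible 𝓕 Φ) {s t : ℝ≥0} (hst : s ≤ t) (ω : Ω) :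
    cumulative Φ j s ω ≤ cumulative Φ j t ω := by
  rw [← sub_nonneg, h.cumulative_sub]
  exact intervalIntegral.integral_nonneg (by exact_mod_cast hst) fun r _ ↦ (h.mem_Icc _ ω j).1

theorem cumulative_sub_le (h : IsAdmissible 𝓕 Φ) {s t : ℝ≥0} (hst : s ≤ t) (ω : Ω) :
    cumulative Φ j t ω - cumulative Φ j s ω ≤ t - s := by
  rw [h.cumulative_sub]
  have : ∫ r in (s : ℝ)..t, Φ r.toNNReal ω j ≤ ∫ r in (s : ℝ)..t, (1 : ℝ) :=
    intervalIntegral.integral_mono_on (by exact_mod_cast hst) (h.intervalIntegrable ω j _ _)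
      (by simp) fun r _ ↦ (h.mem_Icc _ ω j).2
  simpa using this

theorem sum_cumulative_sub_le (h : IsAdmissible 𝓕 Φ) {s t : ℝ≥0} (hst : s ≤ t) (ω : Ω) :
    ∑ j, (cumulative Φ j t ω - cumulative Φ j s ω) ≤ t - s := by
  rw [Finset.sum_congr rfl fun j _ ↦ h.cumulative_sub s t ω,
    ← intervalIntegral.integral_finsetSum fun j _ ↦ h.intervalIntegrable ω j _ _]
  have : ∫ r in (s : ℝ)..t, ∑ j, Φ r.toNNReal ω j ≤ ∫ r in (s : ℝ)..t, (1 : ℝ) :=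
    intervalIntegral.integral_mono_on (by exact_mod_cast hst)
      ((intervalIntegrable_const (c := (1 : ℝ))).mono_fun
        (Finset.measurable_fun_sum _ fun j _ ↦ h.measurable_toNNReal ω j).aestronglyMeasurable
        (ae_of_all _ fun r ↦ by
          dsimp only
          rw [Real.norm_of_nonneg (Finset.sum_nonneg fun j _ ↦ (h.mem_Icc _ ω j).1)]
          simpa using h.sum_le_one r.toNNReal ω))
      (by simp) fun r _ ↦ h.sum_le_one _ ω
  simpa using this

theorem cumulative_nonneg (h : IsAdmissible 𝓕 Φ) (t : ℝ≥0) (ω : Ω) :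
    0 ≤ cumulative Φ j t ω := by
  simpa [cumulative_zero] using h.cumulative_mono (j := j) zero_le ω

theorem continuous_cumulative (h : IsAdmissible 𝓕 Φ) (ω : Ω) :
    Continuous fun t ↦ cumulative Φ j t ω := by
  have : Continuous fun t : ℝ ↦ ∫ s in (0 : ℝ)..t, Φ s.toNNReal ω j :=
    intervalIntegral.continuous_primitive (fun a b ↦ h.intervalIntegrable ω j a b) 0
  exact this.comp NNReal.continuous_coe

theorem measurable_cumulative (h : IsAdmissible 𝓕 Φ) (t : ℝ≥0) :
    Measurable[𝓕 t] (cumulative Φ j t) := by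
  have h1 := h.progressive t
  -- Freezing the integrand after `t` leaves the integral up to `t` unchanged and makes the
  -- integrand jointly measurable with respect to `𝓕 t`.
  have h2 : Measurable[(𝓕 t).prod inferInstance, Subtype.instMeasurableSpace.prod (𝓕 t)]
      (fun p : Ω × ℝ ↦ ((⟨min p.2.toNNReal t, Set.mem_Iic.2 (min_le_right _ _)⟩ : Set.Iic t), p.1)) :=
    Measurable.prodMk (Measurable.subtype_mk
      ((measurable_real_toNNReal.comp measurable_snd).min measurable_const)) measurable_fst
  have h3 : Measurable[(𝓕 t).prod inferInstance]
      (fun p : Ω × ℝ ↦ Φ (min p.2.toNNReal t) p.1 j) :=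
    (measurable_pi_apply j).comp (h1.comp h2)
  have h4 : Measurable[𝓕 t]
      (fun ω ↦ ∫ s, Φ (min s.toNNReal t) ω j ∂(volume.restrict (Set.Ioc (0 : ℝ) t))) :=
    (@StronglyMeasurable.integral_prod_right' Ω ℝ ℝ (𝓕 t) _ _ _ _ _ _ h3.stronglyMeasurable).measurable
  convert h4 using 2 with ω
  rw [cumulative, intervalIntegral.integral_of_le t.coe_nonneg]
  refine setIntegral_congr_fun measurableSet_Ioc fun s hs ↦ ?_
  have : s.toNNReal ≤ t := Real.toNNReal_le_iff_le_coe.2 hs.2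
  simp [min_eq_left this]

theorem measurable_controlled (h : IsAdmissible 𝓕 Φ) (hW : IsBrownianBasis 𝓕 W P)
    (t : ℝ≥0) : Measurable[𝓕 t] (controlledProcess W b Φ x j t) := by
  have : controlledProcess W b Φ x j t
      = fun ω ↦ x j + b * t + cumulative Φ j t ω + W j t ω := by
    ext ω; exact h.controlledProcess_eq t ω
  rw [this]
  exact (measurable_const.add (h.measurable_cumulative t)).add (hW.adapted j t)

theorem ae_continuous_controlled (h : IsAdmissible 𝓕 Φ) (hW : IsBrownianBasis 𝓕 W P) :
    ∀ᵐ ω ∂P, Continuous fun t ↦ controlledProcess W b Φ x j t ω := by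
  filter_upwards [(hW.brownian j).cont] with ω hω
  have : (fun t ↦ controlledProcess W b Φ x j t ω)
      = fun t : ℝ≥0 ↦ x j + b * t + cumulative Φ j t ω + W j t ω := by
    ext t; exact h.controlledProcess_eq t ω
  rw [this]
  have := h.continuous_cumulative (j := j) ω
  fun_prop

end IsAdmissible

/-- The path `f` stays above the level `η` along a countable dense subset of `[0, T]`. -/
def StaysAbove (f : ℝ≥0 → ℝ) (T : ℝ≥0) (η : ℝ) : Prop :=
  ∀ k, η ≤ f (min (TopologicalSpace.denseSeq ℝ≥0 k) T)

theorem staysAbove_iff {f : ℝ≥0 → ℝ} (hf : Continuous f) {T : ℝ≥0} {η : ℝ} :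
    StaysAbove f T η ↔ ∀ t ≤ T, η ≤ f t := by
  refine ⟨fun h t ht ↦ ?_, fun h k ↦ h _ (min_le_right _ _)⟩
  have hcl : IsClosed {t | η ≤ f (min t T)} :=
    isClosed_le continuous_const (hf.comp (continuous_id.min continuous_const))
  have := (TopologicalSpace.denseRange_denseSeq ℝ≥0).induction_on
    (p := fun t ↦ η ≤ f (min t T)) t hcl h
  rwa [min_eq_left ht] at this

/-- By compactness, a positive continuous path is bounded away from zero on each `[0, N]`. This
turns survival into countably many conditions. -/
theorem forall_pos_iff {f : ℝ≥0 → ℝ} (hf : Continuous f) :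
    (∀ t, 0 < f t) ↔ ∀ N : ℕ, ∃ k : ℕ, StaysAbove f N (1 / (k + 1)) := by
  constructor
  · intro h N
    obtain ⟨t, -, ht⟩ := (isCompact_Icc (a := (0 : ℝ≥0)) (b := N)).exists_isMinOn
      ⟨0, by simp⟩ hf.continuousOn
    obtain ⟨k, hk⟩ := exists_nat_one_div_lt (h t)
    refine ⟨k, (staysAbove_iff hf).2 fun s hs ↦ hk.le.trans (ht ⟨zero_le, hs⟩)⟩
  · intro h t
    obtain ⟨N, hN⟩ := exists_nat_ge t
    obtain ⟨k, hk⟩ := h N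
    have := (staysAbove_iff hf).1 hk t hN
    exact lt_of_lt_of_le (by positivity) this

theorem IsAdmissible.measurableSet_staysAbove (h : IsAdmissible 𝓕 Φ)
    (hW : IsBrownianBasis 𝓕 W P) (T : ℝ≥0) (η : ℝ) :
    MeasurableSet {ω | StaysAbove (fun t ↦ controlledProcess W b Φ x j t ω) T η} := by
  simp only [StaysAbove, Set.ofPred_forall]
  refine MeasurableSet.iInter fun k ↦ measurableSet_le measurable_const ?_
  exact (h.measurable_controlled hW _).mono (𝓕.le _) le_rfl

theorem IsAdmissible.nullMeasurableSet_survive (h : IsAdmissible 𝓕 Φ)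
    (hW : IsBrownianBasis 𝓕 W P) :
    NullMeasurableSet {ω | ∀ t, 0 < controlledProcess W b Φ x j t ω} P := by
  have hm : MeasurableSet {ω | ∀ N : ℕ, ∃ k : ℕ,
      StaysAbove (fun t ↦ controlledProcess W b Φ x j t ω) N (1 / (k + 1))} := by
    simp only [Set.ofPred_forall, Set.ofPred_exists]
    exact MeasurableSet.iInter fun N ↦ MeasurableSet.iUnion fun k ↦
      h.measurableSet_staysAbove hW _ _
  refine hm.nullMeasurableSet.congr ?_
  filter_upwards [h.ae_continuous_controlled (b := b) (x := x) (j := j) hW] with ω hω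
  exact propext (forall_pos_iff hω).symm

theorem survival_eq_indicator :
    survival W b Φ x j = Set.indicator {ω | ∀ t, 0 < controlledProcess W b Φ x j t ω} 1 := by
  simp only [survival, ruinTime_eq_top_iff]

end Basic

/-! ### Surviving paths do not linger at low levels. -/

section Linger

variable {Ω : Type*} {mΩ : MeasurableSpace Ω} {P : Measure Ω}
  {𝓕 : Filtration ℝ≥0 mΩ}
  {W : ℕ → ℝ≥0 → Ω → ℝ} {b : ℝ} {n : ℕ} {Φ : ℝ≥0 → Ω → Fin n → ℝ} {x : Fin n → ℝ} {j : Fin n}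

namespace IsBrownianBasis

theorem measurable (hW : IsBrownianBasis 𝓕 W P) (j : ℕ) (t : ℝ≥0) : Measurable (W j t) :=
  (hW.adapted j t).mono (𝓕.le t) le_rfl

theorem hasLaw_increment (hW : IsBrownianBasis 𝓕 W P) (j : ℕ) {s t : ℝ≥0} (hst : s ≤ t) :
    HasLaw (fun ω ↦ W j t ω - W j s ω) (gaussianReal 0 (t - s)) P := by
  have h := (hW.brownian j).hasLaw_sub t s
  have hd : nndist t.1 s.1 = t - s := by
    ext
    rw [coe_nndist, Real.dist_eq, NNReal.coe_sub hst]
    exact abs_of_nonneg (sub_nonneg.2 hst)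
  rwa [hd] at h

theorem real_increment_le (hW : IsBrownianBasis 𝓕 W P) (j : ℕ) {s t : ℝ≥0} (hst : s ≤ t) (r : ℝ) :
    P.real {ω | W j t ω - W j s ω ≤ r} = (gaussianReal 0 (t - s)).real (Set.Iic r) := by
  have h := hW.hasLaw_increment j hst
  rw [← h.map_eq, map_measureReal_apply_of_aemeasurable h.aemeasurable measurableSet_Iic]
  rfl

/-- Independence is used twice: of the future increments from `𝓕 s`, and of the different Brownian
motions from each other. -/
theorem real_inter_increments_le [IsProbabilityMeasure P] (hW : IsBrownianBasis 𝓕 W P) {s t : ℝ≥0} (hst : s ≤ t)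
    {A : Set Ω} (hA : MeasurableSet[𝓕 s] A) (J : Finset ℕ) (r : ℝ) :
    P.real (A ∩ {ω | ∀ j ∈ J, W j t ω - W j s ω ≤ r})
      = P.real A * (gaussianReal 0 (t - s)).real (Set.Iic r) ^ J.card := by
  have hset : {ω | ∀ j ∈ J, W j t ω - W j s ω ≤ r}
      = ⋂ j ∈ J, (fun ω (t : ℝ≥0) ↦ W j t ω) ⁻¹' {w | w t - w s ≤ r} := by
    ext ω; simp
  have h1 := (iIndepFun_iff_measure_inter_preimage_eq_mul.1 hW.indep) J
    (sets := fun _ ↦ {w : ℝ≥0 → ℝ | w t - w s ≤ r})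
    (fun j _ ↦ measurableSet_le ((measurable_pi_apply t).sub (measurable_pi_apply s))
      measurable_const)
  have h2 := (Indep_iff _ _ P).1 (hW.indep_increments s) {ω | ∀ j ∈ J, W j t ω - W j s ω ≤ r} A
    ⟨{w | ∀ j ∈ J, w (j, t - s) ≤ r}, by
      have : {w : ℕ × ℝ≥0 → ℝ | ∀ j ∈ J, w (j, t - s) ≤ r}
          = ⋂ j ∈ J, {w | w (j, t - s) ≤ r} := by ext; simp
      rw [this]
      exact Finset.measurableSet_biInter _ fun j _ ↦
        measurableSet_le (measurable_pi_apply _) measurable_const, by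
      ext ω; simp [add_tsub_cancel_of_le hst]⟩ hA
  rw [Set.inter_comm, measureReal_def, h2, ENNReal.toReal_mul, mul_comm, hset, h1,
    ENNReal.toReal_prod]
  congr 1
  rw [← Finset.prod_const]
  exact Finset.prod_congr rfl fun j _ ↦ hW.real_increment_le j hst r

end IsBrownianBasis

theorem gaussianReal_real_Iic_pos {v : ℝ≥0} (hv : v ≠ 0) (r : ℝ) :
    0 < (gaussianReal 0 v).real (Set.Iic r) := by
  rw [measureReal_def, ENNReal.toReal_pos_iff]
  refine ⟨pos_iff_ne_zero.2 fun h ↦ ?_, measure_lt_top _ _⟩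
  have := gaussianReal_absolutelyContinuous' 0 hv h
  simp at this

variable [IsProbabilityMeasure P]

namespace IsAdmissible

/-- A controlled coordinate cannot survive while lingering below a fixed level. -/
theorem eventually_real_survive_and_lt (h : IsAdmissible 𝓕 Φ) (hW : IsBrownianBasis 𝓕 W P)
    (j : Fin n) (K : ℝ) {ε : ℝ} (hε : 0 < ε) :
    ∀ᶠ N : ℕ in atTop, P.real {ω | (∀ t, 0 < controlledProcess W b Φ x j t ω) ∧
      controlledProcess W b Φ x j N ω < K} ≤ ε := by
  set X := controlledProcess W b Φ x j with hX
  have hXm (t : ℝ≥0) : Measurable[𝓕 t] (X t) := h.measurable_controlled hW t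
  -- Positivity is tested at integer times only, which gives a decreasing sequence of events with `A
  -- N` in `𝓕 N`.
  set A : ℕ → Set Ω := fun N ↦ {ω | ∀ k : ℕ, k ≤ N → 0 < X k ω} with hA
  have hAm (N : ℕ) : MeasurableSet[𝓕 N] (A N) := by
    simp only [hA, Set.ofPred_forall]
    refine MeasurableSet.iInter fun k ↦ MeasurableSet.iInter fun hk ↦ ?_
    exact measurableSet_lt measurable_const
      ((hXm k).mono (𝓕.mono (by exact_mod_cast hk)) le_rfl)
  -- From below `K`, drift adds at most `|b| + 1` in one unit of time, so an increment of at most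
  -- `-(K + |b| + 1)` is fatal. Each visit below `K` thus costs a fixed proportion `δ` of its
  -- probability, while the total losses `P (A N) - P (A (N + 1))` tend to zero.
  set δ := (gaussianReal 0 1).real (Set.Iic (-(K + |b| + 1))) with hδ
  have hδ0 : 0 < δ := gaussianReal_real_Iic_pos one_ne_zero _
  have hanti : Antitone fun N ↦ P.real (A N) := fun M N hMN ↦
    measureReal_mono fun ω hω k hk ↦ hω k (hk.trans hMN)
  have hlim := tendsto_atTop_ciInf hanti ⟨0, by rintro _ ⟨N, rfl⟩; exact measureReal_nonneg⟩
  have hdiff : Tendsto (fun N ↦ P.real (A N) - P.real (A (N + 1))) atTop (𝓝 0) := by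
    simpa using hlim.sub ((tendsto_add_atTop_iff_nat 1).2 hlim)
  filter_upwards [hdiff.eventually_le_const (mul_pos hδ0 hε)] with N hN
  set B := A N ∩ {ω | X N ω < K} with hB
  have hBm : MeasurableSet[𝓕 N] B :=
    (hAm N).inter (measurableSet_lt (hXm N) measurable_const)
  have hstep := hW.real_inter_increments_le (s := N) (t := N + 1) (by simp) hBm {(j : ℕ)}
    (-(K + |b| + 1))
  rw [add_tsub_cancel_left, Finset.card_singleton, pow_one, ← hδ] at hstep
  have hsub : B ∩ {ω | ∀ i ∈ ({(j : ℕ)} : Finset ℕ), W i (N + 1) ω - W i N ω ≤ -(K + |b| + 1)}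
      ⊆ A N \ A (N + 1) := by
    rintro ω ⟨⟨h1, h2⟩, h3⟩
    refine ⟨h1, fun h4 ↦ ?_⟩
    have h5 := h4 (N + 1) le_rfl
    have h3 := h3 j (by simp)
    simp only [Set.mem_ofPred_eq, hX, h.controlledProcess_eq] at h2 h5
    have h6 := h.cumulative_sub_le (j := j) (s := N) (t := N + 1) (by simp) ω
    push_cast at h2 h5 h6
    linarith [le_abs_self b]
  have h1 : P.real (A N \ A (N + 1)) = P.real (A N) - P.real (A (N + 1)) :=
    measureReal_sdiff (fun ω hω k hk ↦ hω k (hk.trans (Nat.le_succ N))) (𝓕.le _ _ (hAm _))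
  have h2 : P.real B * δ ≤ ε * δ := by
    rw [← hstep, mul_comm ε]
    exact (measureReal_mono hsub).trans (h1.le.trans hN)
  refine le_trans (measureReal_mono ?_) (le_of_mul_le_mul_right h2 hδ0)
  rintro ω ⟨h1, h2⟩
  exact ⟨fun k _ ↦ h1 k, h2⟩

/-- A surviving coordinate stays above some positive level on a bounded time interval. -/
theorem exists_real_survive_and_not_staysAbove (h : IsAdmissible 𝓕 Φ)
    (hW : IsBrownianBasis 𝓕 W P) (j : Fin n) (N : ℕ) {ε : ℝ} (hε : 0 < ε) :
    ∀ᶠ k : ℕ in atTop, P.real {ω | (∀ t, 0 < controlledProcess W b Φ x j t ω) ∧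
      ¬ StaysAbove (fun t ↦ controlledProcess W b Φ x j t ω) N (1 / (k + 1))} ≤ ε := by
  set D : ℕ → Set Ω := fun k ↦ {ω | (∀ t, 0 < controlledProcess W b Φ x j t ω) ∧
      ¬ StaysAbove (fun t ↦ controlledProcess W b Φ x j t ω) N (1 / (k + 1))} with hD
  have hDm (k : ℕ) : NullMeasurableSet (D k) P :=
    (h.nullMeasurableSet_survive hW).inter (h.measurableSet_staysAbove hW _ _).compl.nullMeasurableSet
  have hanti : Antitone D := by
    rintro k l hkl ω ⟨h1, h2⟩
    refine ⟨h1, fun h3 ↦ h2 fun i ↦ le_trans ?_ (h3 i)⟩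
    exact one_div_le_one_div_of_le (by positivity) (by simpa using hkl)
  have hzero : P (⋂ k, D k) = 0 := by
    rw [← compl_compl (⋂ k, D k)]
    refine mem_ae_iff.1 ?_
    filter_upwards [h.ae_continuous_controlled (b := b) (x := x) (j := j) hW] with ω hω hmem
    simp only [Set.mem_iInter] at hmem
    obtain ⟨k, hk⟩ := (forall_pos_iff hω).1 (hmem 0).1 N
    exact (hmem k).2 hk
  have hlim := tendsto_measure_iInter_atTop hDm hanti ⟨0, measure_ne_top P _⟩
  rw [hzero] at hlim
  have := (ENNReal.tendsto_toReal ENNReal.zero_ne_top).comp hlim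
  exact this.eventually_le_const hε

end IsAdmissible

end Linger

/-! ### Brownian motion with positive drift rarely falls far. -/

section LineBound

variable {Ω : Type*} {mΩ : MeasurableSpace Ω} {P : Measure Ω}
  {𝓕 : Filtration ℝ≥0 mΩ} {W : ℕ → ℝ≥0 → Ω → ℝ}

namespace IsBrownianBasis

theorem integrable_exp_increment (hW : IsBrownianBasis 𝓕 W P) (j : ℕ) {s t : ℝ≥0} (hst : s ≤ t)
    (a : ℝ) : Integrable (fun ω ↦ Real.exp (a * (W j t ω - W j s ω))) P := by
  have h := hW.hasLaw_increment j hst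
  have := integrable_exp_mul_gaussianReal (μ := 0) (v := t - s) a
  rw [← h.map_eq] at this
  exact this.comp_aemeasurable h.aemeasurable

theorem integral_exp_increment (hW : IsBrownianBasis 𝓕 W P) (j : ℕ) {s t : ℝ≥0} (hst : s ≤ t)
    (a : ℝ) : ∫ ω, Real.exp (a * (W j t ω - W j s ω)) ∂P = Real.exp ((t - s) * a ^ 2 / 2) := by
  have h := mgf_gaussianReal (hW.hasLaw_increment j hst).map_eq a
  rw [mgf] at h
  rw [h, NNReal.coe_sub hst]
  simp

/-- Doob's maximal inequality for the exponential martingale of the increments of a Brownian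
motion after time `T`, on a finite grid of mesh `δ`. -/
theorem measure_exists_grid_add_increment_nonpos_le [IsProbabilityMeasure P]
    (hW : IsBrownianBasis 𝓕 W P) (j : ℕ)
    (T δ : ℝ≥0) {c : ℝ} (hc : 0 < c) (K : ℝ) (n : ℕ) :
    P {ω | ∃ k ≤ n, K + c * (k * δ) + (W j (T + k * δ) ω - W j T ω) ≤ 0}
      ≤ ENNReal.ofReal (Real.exp (-(2 * c * K))) := by
  let 𝒢 : Filtration ℕ mΩ :=
    { seq := fun k ↦ 𝓕 (T + k * δ)
      mono' := fun k l hkl ↦ 𝓕.mono (by gcongr)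
      le' := fun k ↦ 𝓕.le _ }
  have hle (k : ℕ) : T + k * δ ≤ T + (k + 1 : ℕ) * δ := by gcongr; simp
  -- This is `exp (-2c (B_t + c t))` at `t = k δ`. The exponent `-2c` is the one that makes it a
  -- martingale of mean one, and it is at least `exp (2cK)` whenever `K + c t + B_t ≤ 0`.
  set M : ℕ → Ω → ℝ := fun k ω ↦
    Real.exp (-(2 * c) * (W j (T + k * δ) ω - W j T ω)) * Real.exp (-(2 * c ^ 2 * (k * δ))) with hM
  have hMm (k : ℕ) : StronglyMeasurable[𝒢 k] (M k) := by
    refine Measurable.stronglyMeasurable (Measurable.mul_const (Real.measurable_exp.comp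
      (Measurable.const_mul (Measurable.sub (m := 𝒢 k) (f := W j (T + k * δ)) (g := W j T)
      (hW.adapted j _) ?_) _)) _)
    exact (hW.adapted j T).mono (𝓕.mono (by simp)) le_rfl
  have hMi (k : ℕ) : Integrable (M k) P :=
    (hW.integrable_exp_increment j (by simp) _).mul_const _
  have hMint (k : ℕ) : ∫ ω, M k ω ∂P = 1 := by
    rw [hM, integral_mul_const, hW.integral_exp_increment j (by simp), ← Real.exp_add,
      Real.exp_eq_one_iff]
    push_cast
    ring
  have hmart : Martingale M 𝒢 P := by
    refine martingale_nat hMm hMi fun k ↦ ?_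
    set R : Ω → ℝ := fun ω ↦ Real.exp (-(2 * c) *
      (W j (T + (k + 1 : ℕ) * δ) ω - W j (T + k * δ) ω)) * Real.exp (-(2 * c ^ 2 * δ)) with hR
    have hRi : Integrable R P := (hW.integrable_exp_increment j (hle k) _).mul_const _
    have hMR : M (k + 1) = M k * R := by
      ext ω
      simp only [hM, hR, Pi.mul_apply, ← Real.exp_add]
      congr 1
      push_cast
      ring
    have hRm : StronglyMeasurable[MeasurableSpace.comap (fun ω (p : ℕ × ℝ≥0) ↦
        W p.1 (T + k * δ + p.2) ω - W p.1 (T + k * δ) ω) inferInstance] R := by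
      have : R = (fun w : ℕ × ℝ≥0 → ℝ ↦ Real.exp (-(2 * c) * w (j, δ)) *
          Real.exp (-(2 * c ^ 2 * δ))) ∘ (fun ω (p : ℕ × ℝ≥0) ↦
        W p.1 (T + k * δ + p.2) ω - W p.1 (T + k * δ) ω) := by
        ext ω
        simp only [hR, Function.comp]
        congr 4
        push_cast
        ring_nf
      rw [this]
      refine Measurable.stronglyMeasurable (Measurable.comp ?_ (comap_measurable _))
      fun_prop
    have hle1 : MeasurableSpace.comap (fun ω (p : ℕ × ℝ≥0) ↦
        W p.1 (T + k * δ + p.2) ω - W p.1 (T + k * δ) ω) inferInstance ≤ mΩ :=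
      measurable_iff_comap_le.1 <| measurable_pi_iff.2 fun p ↦
        (hW.measurable _ _).sub (hW.measurable _ _)
    have h1 := condExp_indep_eq hle1 (𝓕.le (T + k * δ)) hRm (hW.indep_increments (T + k * δ))
    have h2 : ∫ ω, R ω ∂P = 1 := by
      rw [hR, integral_mul_const, hW.integral_exp_increment j (hle k), ← Real.exp_add,
        Real.exp_eq_one_iff]
      push_cast
      ring
    rw [hMR]
    have h3 := condExp_mul_of_stronglyMeasurable_left (m := 𝒢 k) (μ := P) (hMm k)
      (hMR ▸ hMi (k + 1)) hRi
    filter_upwards [h1, h3] with ω hω1 hω3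
    have hω1' : (P[R | 𝒢 k]) ω = 1 := hω1.trans h2
    rw [hω3, Pi.mul_apply, hω1', mul_one]
  set l : ℝ≥0 := ⟨Real.exp (2 * c * K), (Real.exp_pos _).le⟩ with hl
  have hmax := maximal_ineq hmart.submartingale (fun k ω ↦ by positivity) (ε := l) n
  set S := {ω | (l : ℝ) ≤ (Finset.range (n + 1)).sup' Finset.nonempty_range_add_one
    fun k ↦ M k ω} with hS
  have hsub : {ω | ∃ k ≤ n, K + c * (k * δ) + (W j (T + k * δ) ω - W j T ω) ≤ 0} ⊆ S := by
    rintro ω ⟨k, hk, hω⟩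
    refine Finset.le_sup'_of_le (fun k ↦ M k ω) (Finset.mem_range.2 (Nat.lt_succ_of_le hk)) ?_
    simp only [hM, ← Real.exp_add]
    change Real.exp (2 * c * K) ≤ _
    rw [Real.exp_le_exp]
    nlinarith
  have hint : ∫ ω in S, M n ω ∂P ≤ 1 := by
    rw [← hMint n]
    exact setIntegral_le_integral (hMi n) (ae_of_all _ fun ω ↦ by positivity)
  have hmul : (l : ENNReal) * P S ≤ 1 := hmax.trans (by simpa using ENNReal.ofReal_le_ofReal hint)
  have hl' : (l : ENNReal) = ENNReal.ofReal (Real.exp (2 * c * K)) := by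
    rw [← ENNReal.ofReal_coe_nnreal]; rfl
  rw [hl'] at hmul
  refine (measure_mono hsub).trans ?_
  rw [Real.exp_neg, ENNReal.ofReal_inv_of_pos (Real.exp_pos _)]
  rw [mul_comm] at hmul
  exact ENNReal.le_inv_iff_mul_le.2 hmul

/-- A Brownian motion with positive drift `c` started after time `T` from level `K` is unlikely to
reach `0` when `K` is large. -/
theorem real_exists_add_increment_nonpos_le [IsProbabilityMeasure P]
    (hW : IsBrownianBasis 𝓕 W P) (j : ℕ)
    (T : ℝ≥0) {c : ℝ} (hc : 0 < c) (K : ℝ) :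
    P.real {ω | ∃ s : ℝ≥0, K + c * s + (W j (T + s) ω - W j T ω) ≤ 0}
      ≤ Real.exp (-(2 * c * (K - 1))) := by
  -- The mesh `1 / (n + 1)` tends to zero and the horizon `n + 1` to infinity. Lowering the level to
  -- `K - 1` makes the crossing strict, so by continuity it is seen at grid points for all large
  -- `n`. The events need not be monotone in `n`, hence the passage through their lower limit.
  set D : ℕ → Set Ω := fun n ↦ {ω | ∃ k ≤ (n + 1) ^ 2, (K - 1) + c * (k * (1 / (n + 1) : ℝ≥0)) +
    (W j (T + k * (1 / (n + 1) : ℝ≥0)) ω - W j T ω) ≤ 0} with hD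
  have hDle (n : ℕ) : P (D n) ≤ ENNReal.ofReal (Real.exp (-(2 * c * (K - 1)))) :=
    hW.measure_exists_grid_add_increment_nonpos_le j T (1 / (n + 1)) hc (K - 1) _
  have hsub : ∀ᵐ ω ∂P, ω ∈ {ω | ∃ s : ℝ≥0, K + c * s + (W j (T + s) ω - W j T ω) ≤ 0} →
      ω ∈ ⋃ m, ⋂ n ≥ m, D n := by
    filter_upwards [(hW.brownian j).cont] with ω hω
    rintro ⟨s, hs⟩
    suffices ∀ᶠ n in atTop, ω ∈ D n by simpa [eventually_atTop] using this
    have hcont : Continuous fun r : ℝ≥0 ↦ (K - 1) + c * r + (W j (T + r) ω - W j T ω) := by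
      fun_prop
    have hgrid : Tendsto (fun n : ℕ ↦ (⌊s * (n + 1)⌋₊ : ℝ≥0) * (1 / (n + 1))) atTop (𝓝 s) := by
      have h1 := (tendsto_nat_floor_mul_div_atTop (R := ℝ) s.coe_nonneg).comp
        (tendsto_natCast_atTop_atTop.comp (tendsto_add_atTop_nat 1))
      rw [← NNReal.tendsto_coe]
      refine h1.congr fun n ↦ ?_
      simp only [Function.comp, NNReal.coe_mul, NNReal.coe_natCast, div_eq_mul_inv]
      have h2 : ⌊s * (n + 1)⌋₊ = ⌊(s : ℝ) * (n + 1 : ℕ)⌋₊ := by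
        refine eq_of_forall_le_iff fun k ↦ ?_
        rw [Nat.le_floor_iff zero_le, Nat.le_floor_iff (by positivity)]
        rw [← NNReal.coe_le_coe]
        push_cast
        rfl
      rw [h2]
      push_cast
      simp
    have h2 := (hcont.tendsto s).comp hgrid
    have h3 : (K - 1) + c * s + (W j (T + s) ω - W j T ω) < 0 := by linarith
    obtain ⟨m, hm⟩ := exists_nat_ge s
    filter_upwards [h2.eventually (gt_mem_nhds h3), eventually_ge_atTop m] with n hn hmn
    refine ⟨⌊s * (n + 1)⌋₊, ?_, ?_⟩
    · refine Nat.floor_le_of_le ?_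
      have h4 : s ≤ n + 1 := hm.trans (by exact_mod_cast hmn.trans (Nat.le_succ n))
      calc s * (n + 1) ≤ (n + 1) * (n + 1) := by gcongr
        _ = ((n + 1) ^ 2 : ℕ) := by push_cast; ring
    · have := hn.le
      simp only [Function.comp] at this
      push_cast at this ⊢
      exact this
  have h1 : P {ω | ∃ s : ℝ≥0, K + c * s + (W j (T + s) ω - W j T ω) ≤ 0}
      ≤ ENNReal.ofReal (Real.exp (-(2 * c * (K - 1)))) :=
    calc _ ≤ P (⋃ m, ⋂ n ≥ m, D n) := measure_mono_ae hsub
      _ = ⨆ m, P (⋂ n ≥ m, D n) := Monotone.measure_iUnion fun m m' hm ↦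
        Set.biInter_subset_biInter_left fun n hn ↦ le_trans hm hn
      _ ≤ _ := iSup_le fun m ↦ (measure_mono (Set.biInter_subset_of_mem le_rfl)).trans (hDle m)
  exact ENNReal.toReal_le_of_le_ofReal (Real.exp_pos _).le h1

end IsBrownianBasis

end LineBound

/-! ### Joint ruin under nonpositive total drift. -/

section TotalRuin

variable {Ω : Type*} {mΩ : MeasurableSpace Ω} {P : Measure Ω}
  {𝓕 : Filtration ℝ≥0 mΩ}
  {W : ℕ → ℝ≥0 → Ω → ℝ} {b : ℝ} {n : ℕ} {Φ : ℝ≥0 → Ω → Fin n → ℝ} {x : Fin n → ℝ} {j : Fin n}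

/-- Brownian scaling: a fall by `r` within time `r ^ 2` has a probability that does not depend on
`r`. -/
theorem gaussianReal_real_Iic_neg_sq {r : ℝ≥0} (hr : 0 < r) :
    (gaussianReal 0 (r ^ 2)).real (Set.Iic (-r : ℝ)) = (gaussianReal 0 1).real (Set.Iic (-1)) := by
  have h := gaussianReal_map_const_mul (μ := 0) (v := 1) (r : ℝ)
  have h2 : gaussianReal (r * 0) (NNReal.mk ((r : ℝ) ^ 2) (sq_nonneg _) * 1) = gaussianReal 0 (r ^ 2) := by
    congr 1
    · simp
    · ext; simp
  rw [← h2, ← h, map_measureReal_apply (by fun_prop) measurableSet_Iic]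
  congr 1
  ext y
  simp only [Set.mem_preimage, Set.mem_Iic]
  have : (0 : ℝ) < r := hr
  constructor <;> intro h <;> nlinarith

/-- If the total drift of all coordinates is nonpositive, they cannot all survive. -/
theorem IsAdmissible.real_forall_pos_eq_zero [IsProbabilityMeasure P] (h : IsAdmissible 𝓕 Φ)
    (hW : IsBrownianBasis 𝓕 W P) (hn : 1 ≤ n) (hb : n * b + 1 ≤ 0) :
    P.real {ω | ∀ j t, 0 < controlledProcess W b Φ x j t ω} = 0 := by
  set X := controlledProcess W b Φ x with hX
  have hXm (j : Fin n) (t : ℝ≥0) : Measurable[𝓕 t] (X j t) := h.measurable_controlled hW t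
  set A : ℕ → Set Ω := fun N ↦ {ω | ∀ k : ℕ, k ≤ N → ∀ j, 0 < X j k ω} with hA
  have hAm (N : ℕ) : MeasurableSet[𝓕 N] (A N) := by
    simp only [hA, Set.ofPred_forall]
    refine MeasurableSet.iInter fun k ↦ MeasurableSet.iInter fun hk ↦ MeasurableSet.iInter fun j ↦ ?_
    exact measurableSet_lt measurable_const
      ((hXm j k).mono (𝓕.mono (by exact_mod_cast hk)) le_rfl)
  set δ := (gaussianReal 0 1).real (Set.Iic (-1)) with hδ
  have hδ0 : 0 < δ := gaussianReal_real_Iic_pos one_ne_zero _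
  have hanti : Antitone A := fun M N hMN ω hω k hk ↦ hω k (hk.trans hMN)
  set p := P.real (⋂ N, A N) with hp
  have hn0 : (0 : ℝ) < n := by exact_mod_cast hn
  -- If the coordinates sum to at most `n R` at time `k` and each Brownian motion falls by `R`
  -- within time `R ^ 2`, then the sum ends at or below `(n b + 1) R ^ 2 ≤ 0`. The fall has
  -- probability `δ ^ n` for every `R`, so letting `R → ∞` removes the error term, and `k → ∞` then
  -- gives `p ≤ p (1 - δ ^ n)`.
  have hbound (k : ℕ) (R : ℕ) (hR : 0 < R) :
      p ≤ P.real (A k) * (1 - δ ^ n) + P.real {ω | n * (R : ℝ) < ∑ j, X j k ω} := by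
    set G := {ω | ∀ i ∈ Finset.range n, W i (k + R ^ 2) ω - W i k ω ≤ -(R : ℝ)} with hG
    have hGm : MeasurableSet G := by
      simp only [hG, Set.ofPred_forall]
      exact MeasurableSet.iInter fun i ↦ MeasurableSet.iInter fun _ ↦
        measurableSet_le ((hW.measurable _ _).sub (hW.measurable _ _)) measurable_const
    have h1 := hW.real_inter_increments_le (s := k) (t := k + R ^ 2) (by simp) (hAm k)
      (Finset.range n) (-(R : ℝ))
    have h2 := gaussianReal_real_Iic_neg_sq (r := R) (by exact_mod_cast hR)
    rw [NNReal.coe_natCast] at h2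
    rw [add_tsub_cancel_left, Finset.card_range, h2, ← hδ] at h1
    have h3 : P.real (A k \ G) = P.real (A k) * (1 - δ ^ n) := by
      have := measureReal_inter_add_sdiff (μ := P) (s := A k) hGm
      rw [h1] at this
      linarith
    rw [← h3]
    refine (measureReal_mono ?_).trans (measureReal_union_le _ _)
    intro ω hω
    rw [Set.mem_iInter] at hω
    by_contra hcon
    simp only [Set.mem_union, not_or, Set.mem_sdiff, not_and, not_not, Set.mem_ofPred_eq,
      not_lt] at hcon
    obtain ⟨h4, h5⟩ := hcon
    have h4 := h4 (hω k)
    have h6 : 0 < ∑ j, X j ((k + R ^ 2 : ℕ) : ℝ≥0) ω :=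
      Finset.sum_pos (fun j _ ↦ hω _ _ le_rfl j) ⟨⟨0, hn⟩, Finset.mem_univ _⟩
    have h7 : ∑ j : Fin n, (W j (k + R ^ 2) ω - W j k ω) ≤ ∑ j : Fin n, (-(R : ℝ)) :=
      Finset.sum_le_sum fun j _ ↦ h4 j (by simp)
    have h8 := h.sum_cumulative_sub_le (s := k) (t := k + R ^ 2) (by simp) ω
    simp only [hX, h.controlledProcess_eq] at h5 h6
    push_cast at h5 h6 h8
    simp only [Finset.sum_sub_distrib, Finset.sum_add_distrib, Finset.sum_const,
      Finset.card_univ, Fintype.card_fin, nsmul_eq_mul] at h5 h6 h7 h8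
    nlinarith [sq_nonneg (R : ℝ)]
  have hbound' (k : ℕ) : p ≤ P.real (A k) * (1 - δ ^ n) := by
    have hlim : Tendsto (fun R : ℕ ↦ P.real {ω | n * (R : ℝ) < ∑ j, X j k ω}) atTop (𝓝 0) := by
      have hm : Measurable fun ω ↦ ∑ j, X j k ω :=
        Finset.measurable_fun_sum _ fun j _ ↦ (hXm j k).mono (𝓕.le _) le_rfl
      have := tendsto_measure_iInter_atTop (μ := P)
        (s := fun R : ℕ ↦ {ω | n * (R : ℝ) < ∑ j, X j k ω})
        (fun R ↦ (measurableSet_lt measurable_const hm).nullMeasurableSet)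
        (fun R S hRS ω hω ↦ by
          have : (R : ℝ) ≤ S := by exact_mod_cast hRS
          exact lt_of_le_of_lt (mul_le_mul_of_nonneg_left this hn0.le) hω) ⟨0, measure_ne_top P _⟩
      have he : ⋂ R : ℕ, {ω | n * (R : ℝ) < ∑ j, X j k ω} = ∅ := by
        refine Set.eq_empty_iff_forall_notMem.2 fun ω hω ↦ ?_
        rw [Set.mem_iInter] at hω
        obtain ⟨R, hR⟩ := exists_nat_ge ((∑ j, X j k ω) / n)
        have := hω R
        rw [div_le_iff₀ hn0] at hR
        simp only [Set.mem_ofPred_eq] at this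
        linarith
      rw [he, measure_empty] at this
      exact (ENNReal.tendsto_toReal ENNReal.zero_ne_top).comp this
    have := hlim.const_add (P.real (A k) * (1 - δ ^ n))
    rw [add_zero] at this
    refine ge_of_tendsto this ?_
    filter_upwards [eventually_gt_atTop 0] with R hR using hbound k R hR
  have hlim : Tendsto (fun k ↦ P.real (A k)) atTop (𝓝 p) :=
    (ENNReal.tendsto_toReal (measure_ne_top P _)).comp (tendsto_measure_iInter_atTop
      (fun k ↦ ((𝓕.le _) _ (hAm k)).nullMeasurableSet) hanti ⟨0, measure_ne_top P _⟩)
  have hp1 : p ≤ p * (1 - δ ^ n) :=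
    ge_of_tendsto (hlim.mul_const _) (Eventually.of_forall hbound')
  have hp0 : p ≤ 0 := by
    have := pow_pos hδ0 n
    nlinarith
  refine le_antisymm (le_trans (measureReal_mono ?_) hp0) measureReal_nonneg
  exact fun ω hω ↦ Set.mem_iInter.2 fun N k _ j ↦ hω j k

theorem valueV_eq_zero [IsProbabilityMeasure P] (hW : IsBrownianBasis 𝓕 W P) (hn : 1 ≤ n)
    (hb : n * b + 1 ≤ 0) : valueV 𝓕 W P b n x = 0 := by
  rw [valueV]
  have : ∀ Φ : {Φ : ℝ≥0 → Ω → Fin n → ℝ // IsAdmissible 𝓕 Φ},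
      ∫ ω, ∏ j, survival W b Φ.1 x j ω ∂P = 0 := by
    rintro ⟨Φ, h⟩
    have h1 := h.real_forall_pos_eq_zero (x := x) hW hn hb
    rw [measureReal_eq_zero_iff] at h1
    refine integral_eq_zero_of_ae ?_
    filter_upwards [measure_eq_zero_iff_ae_notMem.1 h1] with ω hω
    simp only [not_forall] at hω
    obtain ⟨j, hj⟩ := hω
    refine Finset.prod_eq_zero (Finset.mem_univ j) ?_
    rcases survival_eq_zero_or_one (W := W) (b := b) (Φ := Φ) (x := x) (j := j) ω with h2 | h2
    · exact h2
    · exact absurd (survival_eq_one_iff.1 h2) (by simpa using hj)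
  simp [this]

end TotalRuin

/-! ### Independence of the optimal performance from the Brownian basis. -/

section DynamicProgramming

variable {Ω : Type*} {mΩ : MeasurableSpace Ω} {P : Measure Ω} {𝓕 : Filtration ℝ≥0 mΩ}
  {W W' : ℕ → ℝ≥0 → Ω → ℝ}

theorem IsBrownianReal.map_eq_map [IsProbabilityMeasure P] {B B' : ℝ≥0 → Ω → ℝ}
    (hB : IsBrownianReal B P) (hB' : IsBrownianReal B' P)
    (hm : ∀ t, Measurable (B t)) (hm' : ∀ t, Measurable (B' t)) :
    P.map (fun ω t ↦ B t ω) = P.map (fun ω t ↦ B' t ω) :=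
  (map_eq_iff_forall_finset_map_restrict_eq
    (measurable_pi_iff.2 hm).aemeasurable
    (measurable_pi_iff.2 hm').aemeasurable).2
    fun I ↦ (hB.hasLaw I).map_eq.trans (hB'.hasLaw I).map_eq.symm

namespace IsBrownianBasis

theorem measurable_path (hW : IsBrownianBasis 𝓕 W P) :
    Measurable fun ω (p : ℕ × ℝ≥0) ↦ W p.1 p.2 ω :=
  measurable_pi_iff.2 fun p ↦ hW.measurable p.1 p.2

theorem map_path_eq [IsProbabilityMeasure P] (hW : IsBrownianBasis 𝓕 W P)
    (hW' : IsBrownianBasis 𝓕 W' P) :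
    P.map (fun ω (p : ℕ × ℝ≥0) ↦ W p.1 p.2 ω) = P.map (fun ω (p : ℕ × ℝ≥0) ↦ W' p.1 p.2 ω) := by
  have h : ∀ {W : ℕ → ℝ≥0 → Ω → ℝ}, IsBrownianBasis 𝓕 W P →
      Measurable fun ω (j : ℕ) (t : ℝ≥0) ↦ W j t ω := fun hW ↦
    measurable_pi_iff.2 fun j ↦ measurable_pi_iff.2 fun t ↦ hW.measurable j t
  have h1 : P.map (fun ω (j : ℕ) (t : ℝ≥0) ↦ W j t ω)
      = P.map (fun ω (j : ℕ) (t : ℝ≥0) ↦ W' j t ω) := by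
    rw [hW.indep.map_fun_eq_infinitePi_map₀ (h hW).aemeasurable,
      hW'.indep.map_fun_eq_infinitePi_map₀ (h hW').aemeasurable]
    congr 1
    ext1 j
    exact IsBrownianReal.map_eq_map (hW.brownian j) (hW'.brownian j) (hW.measurable j)
      (hW'.measurable j)
  have hu : Measurable fun (w : ℕ → ℝ≥0 → ℝ) (p : ℕ × ℝ≥0) ↦ w p.1 p.2 :=
    measurable_pi_iff.2 fun p ↦ (measurable_pi_apply p.2).comp (measurable_pi_apply p.1)
  have h2 := congrArg (Measure.map fun (w : ℕ → ℝ≥0 → ℝ) (p : ℕ × ℝ≥0) ↦ w p.1 p.2) h1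
  rwa [Measure.map_map hu (h hW), Measure.map_map hu (h hW')] at h2

end IsBrownianBasis

/-- The family of paths `W`, stopped at time `t`. -/
def stoppedPath (W : ℕ → ℝ≥0 → Ω → ℝ) (t : ℝ≥0) (ω : Ω) (p : ℕ × ℝ≥0) : ℝ :=
  W p.1 (min p.2 t) ω

/-- The increments of the paths `W` over the time interval `[s, t]`. -/
def pathIncrement (W : ℕ → ℝ≥0 → Ω → ℝ) (s t : ℝ≥0) (ω : Ω) (p : ℕ × ℝ≥0) : ℝ :=
  W p.1 (min p.2 t) ω - W p.1 (min p.2 s) ω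

theorem stoppedPath_add_pathIncrement (s t : ℝ≥0) (ω : Ω) :
    stoppedPath W s ω + pathIncrement W s t ω = stoppedPath W t ω := by
  ext p; simp [stoppedPath, pathIncrement]

namespace IsBrownianBasis

theorem measurable_stoppedPath (hW : IsBrownianBasis 𝓕 W P) (t : ℝ≥0) :
    Measurable[𝓕 t] (stoppedPath W t) :=
  (@measurable_pi_iff _ _ _ (𝓕 t) _ _).2 fun p ↦ (hW.adapted p.1 _).mono (𝓕.mono (min_le_right _ _)) le_rfl

theorem measurable_pathIncrement (hW : IsBrownianBasis 𝓕 W P) (s t : ℝ≥0) :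
    Measurable (pathIncrement W s t) :=
  measurable_pi_iff.2 fun _ ↦ (hW.measurable _ _).sub (hW.measurable _ _)

theorem map_pathIncrement_eq [IsProbabilityMeasure P] (hW : IsBrownianBasis 𝓕 W P)
    (hW' : IsBrownianBasis 𝓕 W' P) (s t : ℝ≥0) :
    P.map (pathIncrement W s t) = P.map (pathIncrement W' s t) := by
  have hu : Measurable fun (w : ℕ × ℝ≥0 → ℝ) (p : ℕ × ℝ≥0) ↦
      w (p.1, min p.2 t) - w (p.1, min p.2 s) :=
    measurable_pi_iff.2 fun p ↦ (measurable_pi_apply _).sub (measurable_pi_apply _)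
  have h2 := congrArg (Measure.map fun (w : ℕ × ℝ≥0 → ℝ) (p : ℕ × ℝ≥0) ↦
      w (p.1, min p.2 t) - w (p.1, min p.2 s)) (hW.map_path_eq hW')
  rwa [Measure.map_map hu hW.measurable_path, Measure.map_map hu hW'.measurable_path] at h2

theorem map_stoppedPath_eq [IsProbabilityMeasure P] (hW : IsBrownianBasis 𝓕 W P)
    (hW' : IsBrownianBasis 𝓕 W' P) (t : ℝ≥0) :
    P.map (stoppedPath W t) = P.map (stoppedPath W' t) := by
  have hu : Measurable fun (w : ℕ × ℝ≥0 → ℝ) (p : ℕ × ℝ≥0) ↦ w (p.1, min p.2 t) :=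
    measurable_pi_iff.2 fun p ↦ measurable_pi_apply _
  have h2 := congrArg (Measure.map fun (w : ℕ × ℝ≥0 → ℝ) (p : ℕ × ℝ≥0) ↦
      w (p.1, min p.2 t)) (hW.map_path_eq hW')
  rwa [Measure.map_map hu hW.measurable_path, Measure.map_map hu hW'.measurable_path] at h2

/-- The increments after `s` are independent of everything known at `s`, so by Tonelli they can be
averaged with `Z` held fixed. -/
theorem lintegral_pathIncrement [IsProbabilityMeasure P] (hW : IsBrownianBasis 𝓕 W P) {s t : ℝ≥0}
    (hst : s ≤ t) {H : Type*} [MeasurableSpace H] {Z : Ω → H} (hZ : Measurable[𝓕 s] Z)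
    {F : H × (ℕ × ℝ≥0 → ℝ) → ENNReal} (hF : Measurable F) :
    ∫⁻ ω, F (Z ω, pathIncrement W s t ω) ∂P
      = ∫⁻ ω, ∫⁻ v, F (Z ω, v) ∂(P.map (pathIncrement W s t)) ∂P := by
  have hZ' : Measurable Z := hZ.mono (𝓕.le s) le_rfl
  have hm := hW.measurable_pathIncrement s t
  have hind : IndepFun Z (pathIncrement W s t) P := by
    rw [IndepFun_iff_Indep]
    refine indep_of_indep_of_le_left
      (indep_of_indep_of_le_left (hW.indep_increments s) ?_).symm ?_
    · rw [← measurable_iff_comap_le]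
      have he : pathIncrement W s t = (fun (w : ℕ × ℝ≥0 → ℝ) (p : ℕ × ℝ≥0) ↦
          w (p.1, min p.2 t - s)) ∘ fun ω (p : ℕ × ℝ≥0) ↦ W p.1 (s + p.2) ω - W p.1 s ω := by
        ext ω p
        simp only [pathIncrement, Function.comp]
        rcases le_total p.2 s with h | h
        · rw [min_eq_left h, min_eq_left (h.trans hst), tsub_eq_zero_of_le h]
          simp
        · rw [min_eq_right h, add_tsub_cancel_of_le (le_min h hst)]
      rw [he]
      exact (measurable_pi_iff.2 fun p ↦ measurable_pi_apply _).comp (comap_measurable _)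
    · exact measurable_iff_comap_le.1 hZ
  have h1 := (indepFun_iff_map_prod_eq_prod_map_map hZ'.aemeasurable hm.aemeasurable).1 hind
  have := Measure.isProbabilityMeasure_map hm.aemeasurable (μ := P)
  calc ∫⁻ ω, F (Z ω, pathIncrement W s t ω) ∂P
      = ∫⁻ y, F y ∂(P.map fun ω ↦ (Z ω, pathIncrement W s t ω)) :=
        (lintegral_map hF (hZ'.prodMk hm)).symm
    _ = ∫⁻ z, ∫⁻ v, F (z, v) ∂(P.map (pathIncrement W s t)) ∂(P.map Z) := by
        rw [h1, lintegral_prod _ hF.aemeasurable]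
    _ = _ := lintegral_map hF.lintegral_prod_right' hZ'

end IsBrownianBasis

/-- A finite family of measurable functions has a measurable maximizer. -/
theorem exists_measurable_argmax {A H : Type*} [Fintype A] [Nonempty A] [MeasurableSpace A]
    [MeasurableSpace H] (f : A → H → ENNReal) (hf : ∀ c, Measurable (f c)) :
    ∃ α : H → A, Measurable α ∧ ∀ c h, f c h ≤ f (α h) h := by
  classical
  suffices ∀ s : Finset A, ∃ α : H → A, Measurable α ∧
      Measurable (fun h ↦ f (α h) h) ∧ ∀ c ∈ s, ∀ h, f c h ≤ f (α h) h by
    obtain ⟨α, h1, -, h2⟩ := this Finset.univ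
    exact ⟨α, h1, fun c h ↦ h2 c (Finset.mem_univ c) h⟩
  intro s
  induction s using Finset.induction_on with
  | empty => exact ⟨fun _ ↦ Classical.arbitrary A, measurable_const, hf _, by simp⟩
  | insert c s _ ih =>
    obtain ⟨α, h1, h2, h3⟩ := ih
    have hs : MeasurableSet {h | f (α h) h ≤ f c h} := measurableSet_le h2 (hf c)
    refine ⟨fun h ↦ if f (α h) h ≤ f c h then c else α h, Measurable.ite hs measurable_const h1,
      ?_, fun d hd h ↦ ?_⟩
    · have : (fun h ↦ f (if f (α h) h ≤ f c h then c else α h) h)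
          = fun h ↦ if f (α h) h ≤ f c h then f c h else f (α h) h := by
        ext h; split_ifs <;> rfl
      rw [this]
      exact Measurable.ite hs (hf c) h2
    · rcases Finset.mem_insert.1 hd with rfl | hd
      · by_cases hh : f (α h) h ≤ f d h
        · simp [hh]
        · simpa [hh] using (not_le.1 hh).le
      · by_cases hh : f (α h) h ≤ f c h
        · simpa [hh] using (h3 d hd h).trans hh
        · simpa [hh] using h3 d hd h

/-- The first `k` entries of the tuple `a`, completed by the constant `a₀`. -/
def truncTuple {A : Type*} {N : ℕ} (a₀ : A) (k : ℕ) (a : Fin N → A) (l : Fin N) : A :=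
  if (l : ℕ) < k then a l else a₀

theorem truncTuple_succ {A : Type*} {N : ℕ} (a₀ : A) (k : Fin N) (a : Fin N → A) :
    truncTuple a₀ (k + 1) a = Function.update (truncTuple a₀ k a) k (a k) := by
  ext l
  by_cases h : l = k
  · subst h; simp [truncTuple]
  · have : (l : ℕ) ≠ k := fun h' ↦ h (Fin.ext h')
    rw [Function.update_of_ne h]
    simp only [truncTuple]
    congr 1
    apply propext
    omega

theorem truncTuple_self {A : Type*} {N : ℕ} (a₀ : A) (a : Fin N → A) : truncTuple a₀ N a = a := by
  ext l; simp [truncTuple]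

/-- For a performance functional depending on finitely many controls with finitely many possible
values, chosen at the times `l * δ`, and on the driving paths, the best performance does not depend
on the Brownian basis. -/
theorem IsBrownianBasis.exists_adapted_lintegral_le [IsProbabilityMeasure P]
    (hW : IsBrownianBasis 𝓕 W P) (hW' : IsBrownianBasis 𝓕 W' P)
    {A : Type*} [Fintype A] [Nonempty A] [MeasurableSpace A] [MeasurableSingletonClass A]
    {N : ℕ} (δ : ℝ≥0) (a : Fin N → Ω → A) (ha : ∀ l : Fin N, Measurable[𝓕 (l * δ)] (a l))
    {F : (Fin N → A) × (ℕ × ℝ≥0 → ℝ) → ENNReal} (hF : Measurable F) :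
    ∃ a' : Fin N → Ω → A, (∀ l : Fin N, Measurable[𝓕 (l * δ)] (a' l)) ∧
      ∫⁻ ω, F (fun l ↦ a l ω, stoppedPath W (N * δ) ω) ∂P
        ≤ ∫⁻ ω, F (fun l ↦ a' l ω, stoppedPath W' (N * δ) ω) ∂P := by
  classical
  let a₀ : A := Classical.arbitrary A
  have htr (k : ℕ) (a : Fin N → Ω → A) (ha : ∀ l : Fin N, Measurable[𝓕 (l * δ)] (a l)) :
      Measurable[𝓕 (k * δ)] fun ω ↦ truncTuple a₀ k (fun l ↦ a l ω) := by
    refine (@measurable_pi_iff _ _ _ (𝓕 (k * δ)) _ _).2 fun l ↦ ?_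
    by_cases h : (l : ℕ) < k
    · simp only [truncTuple, h, if_true]
      exact (ha l).mono (𝓕.mono (by gcongr)) le_rfl
    · simp only [truncTuple, h, if_false]
      exact measurable_const
  -- Quantifying over `F` inside the induction lets each step replace the payoff by its
  -- conditionally optimised version. Padding with `a₀` keeps the type of the history fixed.
  suffices ∀ k ≤ N, ∀ F : (Fin N → A) × (ℕ × ℝ≥0 → ℝ) → ENNReal, Measurable F →
      ∃ a' : Fin N → Ω → A, (∀ l : Fin N, Measurable[𝓕 (l * δ)] (a' l)) ∧
      ∫⁻ ω, F (truncTuple a₀ k fun l ↦ a l ω, stoppedPath W (k * δ) ω) ∂P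
        ≤ ∫⁻ ω, F (truncTuple a₀ k fun l ↦ a' l ω, stoppedPath W' (k * δ) ω) ∂P by
    simpa only [truncTuple_self] using this N le_rfl F hF
  intro k
  induction k with
  | zero =>
    intro _ F hF
    refine ⟨a, ha, le_of_eq ?_⟩
    have h0 : ∀ a : Fin N → A, truncTuple a₀ 0 a = fun _ ↦ a₀ := fun a ↦ by
      ext l; simp [truncTuple]
    simp only [h0]
    have hG : Measurable fun w : ℕ × ℝ≥0 → ℝ ↦ F (fun _ ↦ a₀, w) := hF.comp measurable_prodMk_left
    rw [← lintegral_map (f := fun w ↦ F (fun _ ↦ a₀, w)) hG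
        ((hW.measurable_stoppedPath _).mono (𝓕.le _) le_rfl),
      ← lintegral_map (f := fun w ↦ F (fun _ ↦ a₀, w)) hG
        ((hW'.measurable_stoppedPath _).mono (𝓕.le _) le_rfl), hW.map_stoppedPath_eq hW']
  | succ k ih =>
    intro hk F hF
    have hkN : k < N := hk
    let κ : Fin N := ⟨k, hkN⟩
    set s : ℝ≥0 := k * δ with hs
    set t : ℝ≥0 := (k + 1 : ℕ) * δ with ht
    have hst : s ≤ t := by rw [hs, ht]; gcongr; simp
    set μ := P.map (pathIncrement W s t) with hμ
    have hμ' : P.map (pathIncrement W' s t) = μ := hW'.map_pathIncrement_eq hW s t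
    have : IsProbabilityMeasure μ :=
      Measure.isProbabilityMeasure_map (hW.measurable_pathIncrement s t).aemeasurable
    set F' : (((Fin N → A) × (ℕ × ℝ≥0 → ℝ)) × A) × (ℕ × ℝ≥0 → ℝ) → ENNReal :=
      fun q ↦ F (Function.update q.1.1.1 κ q.1.2, q.1.1.2 + q.2) with hF'
    have hF'm : Measurable F' := by
      refine hF.comp (Measurable.prodMk ?_ ?_)
      · exact (measurable_of_countable
          fun r : (Fin N → A) × A ↦ Function.update r.1 κ r.2).comp
            ((measurable_fst.comp (measurable_fst.comp measurable_fst)).prodMk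
              (measurable_snd.comp measurable_fst))
      · exact (measurable_snd.comp (measurable_fst.comp measurable_fst)).add measurable_snd
    -- Expected payoff when decision `c` is taken at time `s` after history `h`, averaged over the
    -- next increments. Their law `μ` is common to both bases.
    set f : A → (Fin N → A) × (ℕ × ℝ≥0 → ℝ) → ENNReal :=
      fun c h ↦ ∫⁻ v, F' ((h, c), v) ∂μ with hf
    have hfm (c : A) : Measurable (f c) :=
      (hF'm.lintegral_prod_right' (ν := μ)).comp measurable_prodMk_right
    obtain ⟨α, hα, hmax⟩ := exists_measurable_argmax f hfm
    have hGm : Measurable fun h ↦ f (α h) h :=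
      (hF'm.lintegral_prod_right' (ν := μ)).comp (measurable_id.prodMk hα)
    obtain ⟨a', ha', hle⟩ := ih (Nat.le_of_succ_le hk) _ hGm
    set Z : Ω → (Fin N → A) × (ℕ × ℝ≥0 → ℝ) :=
      fun ω ↦ (truncTuple a₀ k fun l ↦ a l ω, stoppedPath W s ω) with hZ
    set Z' : Ω → (Fin N → A) × (ℕ × ℝ≥0 → ℝ) :=
      fun ω ↦ (truncTuple a₀ k fun l ↦ a' l ω, stoppedPath W' s ω) with hZ'
    have hZm : Measurable[𝓕 s] Z := (htr k a ha).prodMk (hW.measurable_stoppedPath s)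
    have hZm' : Measurable[𝓕 s] Z' := (htr k a' ha').prodMk (hW'.measurable_stoppedPath s)
    have hκ : Measurable[𝓕 s] (a κ) := ha κ
    -- The last decision becomes the maximiser at the new history. The history `Z'` ignores entry
    -- `κ`, so overwriting that entry does not alter it.
    refine ⟨Function.update a' κ fun ω ↦ α (Z' ω), fun l ↦ ?_, ?_⟩
    · by_cases h : l = κ
      · subst h
        rw [Function.update_self]
        exact hα.comp hZm'
      · rw [Function.update_of_ne h]
        exact ha' l
    · have e1 (ω : Ω) : F (truncTuple a₀ (k + 1) fun l ↦ a l ω, stoppedPath W t ω)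
          = F' ((Z ω, a κ ω), pathIncrement W s t ω) := by
        simp only [hF', hZ, stoppedPath_add_pathIncrement]
        rw [← truncTuple_succ a₀ κ]
      have e2 (ω : Ω) : F (truncTuple a₀ (k + 1)
            fun l ↦ Function.update a' κ (fun ω ↦ α (Z' ω)) l ω, stoppedPath W' t ω)
          = F' ((Z' ω, α (Z' ω)), pathIncrement W' s t ω) := by
        simp only [hF', hZ', stoppedPath_add_pathIncrement]
        congr 2
        have := truncTuple_succ a₀ κ fun l ↦ Function.update a' κ (fun ω ↦ α (Z' ω)) l ω
        simp only [Function.update_self] at this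
        refine this.trans ?_
        congr 1
        ext l
        by_cases h : (l : ℕ) < k
        · have hne : l ≠ κ := by rintro rfl; exact lt_irrefl _ h
          simp only [truncTuple, κ, h, if_true]
          exact congrFun (Function.update_of_ne hne _ _) ω
        · simp [truncTuple, h, κ]
      simp only [e1, e2]
      rw [hW.lintegral_pathIncrement hst (hZm.prodMk hκ) hF'm,
        hW'.lintegral_pathIncrement (Z := fun ω ↦ (Z' ω, α (Z' ω))) hst
          (hZm'.prodMk (hα.comp hZm')) hF'm, hμ', ← hμ]
      -- The maximiser beats `a κ ω` pointwise, whatever further information in `𝓕 s` that decision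
      -- used.
      exact (lintegral_mono fun ω ↦ hmax (a κ ω) (Z ω)).trans hle

end DynamicProgramming

/-! ### Payoffs of the survival indicators. -/

section Payoff

/-- A payoff which is a nonnegative function of the survival indicators and drops by at most one
for every agent that is lost. -/
structure IsSurvivalPayoff {m : ℕ} (g : (Fin m → ℝ) → ℝ) : Prop where
  measurable : Measurable g
  nonneg : ∀ u, (∀ j, u j = 0 ∨ u j = 1) → 0 ≤ g u
  le_add : ∀ u v, (∀ j, u j = 0 ∨ u j = 1) → (∀ j, v j = 0 ∨ v j = 1) →
    g u ≤ g v + ∑ j, u j * (1 - v j)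

theorem isSurvivalPayoff_prod (m : ℕ) : IsSurvivalPayoff fun u : Fin m → ℝ ↦ ∏ j, u j where
  measurable := by fun_prop
  nonneg u hu := Finset.prod_nonneg fun j _ ↦ by rcases hu j with h | h <;> simp [h]
  le_add u v hu hv := by
    have hsum : ∀ j ∈ Finset.univ, 0 ≤ u j * (1 - v j) := fun j _ ↦ by
      rcases hu j with h | h <;> rcases hv j with h' | h' <;> simp [h, h']
    by_cases h0 : ∃ j, u j = 0
    · obtain ⟨j, hj⟩ := h0
      rw [Finset.prod_eq_zero (Finset.mem_univ j) hj]
      refine add_nonneg (Finset.prod_nonneg fun j _ ↦ ?_) (Finset.sum_nonneg hsum)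
      rcases hv j with h | h <;> simp [h]
    · have hu1 : ∀ j, u j = 1 := fun j ↦ (hu j).resolve_left fun h ↦ h0 ⟨j, h⟩
      by_cases h1 : ∃ j, v j = 0
      · obtain ⟨j, hj⟩ := h1
        rw [Finset.prod_eq_zero (f := v) (Finset.mem_univ j) hj, zero_add]
        refine le_trans ?_ (Finset.single_le_sum hsum (Finset.mem_univ j))
        simp [hu1, hj]
      · have hv1 : ∀ j, v j = 1 := fun j ↦ (hv j).resolve_left fun h ↦ h1 ⟨j, h⟩
        simp [hu1, hv1]

theorem isSurvivalPayoff_sum (m : ℕ) : IsSurvivalPayoff fun u : Fin m → ℝ ↦ ∑ j, u j where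
  measurable := by fun_prop
  nonneg u hu := Finset.sum_nonneg fun j _ ↦ by rcases hu j with h | h <;> simp [h]
  le_add u v hu hv := by
    rw [← Finset.sum_add_distrib]
    refine Finset.sum_le_sum fun j _ ↦ ?_
    rcases hu j with h | h <;> rcases hv j with h' | h' <;> simp [h, h']

variable {Ω : Type*} {mΩ : MeasurableSpace Ω} {P : Measure Ω} {m : ℕ} {g : (Fin m → ℝ) → ℝ}

theorem indicator_one_eq_zero_or_one (A : Set Ω) (ω : Ω) :
    A.indicator (1 : Ω → ℝ) ω = 0 ∨ A.indicator (1 : Ω → ℝ) ω = 1 := by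
  by_cases h : ω ∈ A <;> simp [h]

namespace IsSurvivalPayoff

theorem indicator_le (hg : IsSurvivalPayoff g) (A : Fin m → Set Ω) (ω : Ω) :
    g (fun j ↦ (A j).indicator 1 ω) ≤ g 0 + m := by
  have h01 : ∀ j, (A j).indicator (1 : Ω → ℝ) ω = 0 ∨ (A j).indicator (1 : Ω → ℝ) ω = 1 :=
    fun j ↦ indicator_one_eq_zero_or_one _ ω
  refine (hg.le_add _ 0 h01 (by simp)).trans ?_
  gcongr
  calc ∑ j, (A j).indicator (1 : Ω → ℝ) ω * (1 - (0 : Fin m → ℝ) j) ≤ ∑ j : Fin m, (1 : ℝ) :=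
        Finset.sum_le_sum fun j _ ↦ by rcases h01 j with h | h <;> simp [h]
    _ = m := by simp

theorem integrable [IsProbabilityMeasure P] (hg : IsSurvivalPayoff g) {A : Fin m → Set Ω}
    (hA : ∀ j, NullMeasurableSet (A j) P) :
    Integrable (fun ω ↦ g fun j ↦ (A j).indicator 1 ω) P := by
  have hm : AEMeasurable (fun ω ↦ g fun j ↦ (A j).indicator 1 ω) P :=
    hg.measurable.comp_aemeasurable
      (aemeasurable_pi_lambda _ fun j ↦ aemeasurable_one.indicator₀ (hA j))
  refine Integrable.of_bound hm.aestronglyMeasurable (g 0 + m) (ae_of_all _ fun ω ↦ ?_)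
  rw [Real.norm_of_nonneg (hg.nonneg _ fun j ↦ indicator_one_eq_zero_or_one _ ω)]
  exact hg.indicator_le A ω

/-- Integrates `le_add`. It serves both as monotonicity, when the differences are empty, and as the
error estimate for every approximation. -/
theorem integral_le [IsProbabilityMeasure P] (hg : IsSurvivalPayoff g) {A B : Fin m → Set Ω}
    (hA : ∀ j, NullMeasurableSet (A j) P) (hB : ∀ j, NullMeasurableSet (B j) P) :
    ∫ ω, g (fun j ↦ (A j).indicator 1 ω) ∂P
      ≤ ∫ ω, g (fun j ↦ (B j).indicator 1 ω) ∂P + ∑ j, P.real (A j \ B j) := by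
  have hi (j : Fin m) : Integrable ((A j \ B j).indicator (1 : Ω → ℝ)) P :=
    (integrable_const (1 : ℝ)).indicator₀ ((hA j).diff (hB j))
  have hint (j : Fin m) : ∫ ω, (A j \ B j).indicator (1 : Ω → ℝ) ω ∂P = P.real (A j \ B j) := by
    rw [integral_indicator₀ ((hA j).diff (hB j))]
    simp
  calc ∫ ω, g (fun j ↦ (A j).indicator 1 ω) ∂P
      ≤ ∫ ω, (g (fun j ↦ (B j).indicator 1 ω) + ∑ j, (A j \ B j).indicator (1 : Ω → ℝ) ω) ∂P := by
        refine integral_mono (hg.integrable hA)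
          ((hg.integrable hB).add (integrable_finsetSum _ fun j _ ↦ hi j)) fun ω ↦ ?_
        refine (hg.le_add _ (fun j ↦ (B j).indicator 1 ω)
          (fun j ↦ indicator_one_eq_zero_or_one _ ω)
          fun j ↦ indicator_one_eq_zero_or_one _ ω).trans (le_of_eq ?_)
        congr 1
        refine Finset.sum_congr rfl fun j _ ↦ ?_
        by_cases h : ω ∈ A j <;> by_cases h' : ω ∈ B j <;> simp [h, h']
    _ = _ := by
        rw [integral_add (hg.integrable hB) (integrable_finsetSum _ fun j _ ↦ hi j),
          integral_finsetSum _ fun j _ ↦ hi j]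
        simp only [hint]

end IsSurvivalPayoff

end Payoff

/-! ### Approximation by controls with finitely many values on a time grid. -/

section Grid

variable {Ω : Type*} {mΩ : MeasurableSpace Ω} {P : Measure Ω} {𝓕 : Filtration ℝ≥0 mΩ}
  {m M N : ℕ} {δ : ℝ≥0}

/-- Allocations of `M` equal shares of the unit drift among `m` agents. -/
abbrev GridValue (m M : ℕ) : Type := {v : Fin m → Fin (M + 1) // ∑ j, (v j : ℕ) ≤ M}

instance : Nonempty (GridValue m M) := ⟨⟨0, by simp⟩⟩

/-- The control which allocates the shares `a l` on `[l δ, (l + 1) δ)` for `l < N`, and the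
constant `1 / (m + 1)` to everyone from time `N δ` on. -/
noncomputable def gridControl (δ : ℝ≥0) (a : Fin N → GridValue m M) (t : ℝ≥0) (j : Fin m) : ℝ :=
  ∑ l : Fin N, (if ⌊t / δ⌋₊ = l then ((a l).1 j : ℝ) / M else 0) +
    if N ≤ ⌊t / δ⌋₊ then 1 / ((m : ℝ) + 1) else 0

theorem gridControl_of_floor_eq {a : Fin N → GridValue m M} {t : ℝ≥0} {l : Fin N}
    (h : ⌊t / δ⌋₊ = l) (j : Fin m) : gridControl δ a t j = ((a l).1 j : ℝ) / M := by
  rw [gridControl, Finset.sum_eq_single l]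
  · simp [h]
  · intro k _ hk
    rw [if_neg]
    rw [h]
    exact fun h' ↦ hk (Fin.ext h'.symm)
  · simp

theorem gridControl_of_le_floor {a : Fin N → GridValue m M} {t : ℝ≥0}
    (h : N ≤ ⌊t / δ⌋₊) (j : Fin m) : gridControl δ a t j = 1 / ((m : ℝ) + 1) := by
  rw [gridControl, Finset.sum_eq_zero, if_pos h, zero_add]
  intro l _
  rw [if_neg (by omega)]

theorem sum_gridControl_le_one (a : Fin N → GridValue m M) (t : ℝ≥0) :
    ∑ j, gridControl δ a t j ≤ 1 := by
  rcases lt_or_ge ⌊t / δ⌋₊ N with h | h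
  · simp only [gridControl_of_floor_eq (l := ⟨_, h⟩) rfl]
    rw [← Finset.sum_div]
    refine div_le_one_of_le₀ ?_ (Nat.cast_nonneg M)
    exact_mod_cast (a ⟨_, h⟩).2
  · simp only [gridControl_of_le_floor h]
    rw [Finset.sum_const, Finset.card_univ, Fintype.card_fin, nsmul_eq_mul, mul_one_div]
    exact div_le_one_of_le₀ (by linarith) (by positivity)

theorem gridControl_nonneg (a : Fin N → GridValue m M) (t : ℝ≥0) (j : Fin m) :
    0 ≤ gridControl δ a t j := by
  rw [gridControl]
  refine add_nonneg (Finset.sum_nonneg fun l _ ↦ ?_) ?_ <;> split_ifs <;> positivity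

theorem isAdmissible_gridControl {a : Fin N → Ω → GridValue m M}
    (hδ : 0 < δ) (ha : ∀ l : Fin N, Measurable[𝓕 (l * δ)] (a l)) :
    IsAdmissible 𝓕 fun t ω ↦ gridControl δ (fun l ↦ a l ω) t where
  mem_Icc t ω j := ⟨gridControl_nonneg _ t j,
    (Finset.single_le_sum (fun j _ ↦ gridControl_nonneg _ t j) (Finset.mem_univ j)).trans
      (sum_gridControl_le_one (fun l ↦ a l ω) t)⟩
  sum_le_one t ω := sum_gridControl_le_one _ t
  progressive i := by
    let m₀ : MeasurableSpace (Set.Iic i × Ω) := Subtype.instMeasurableSpace.prod (𝓕 i)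
    have hfloor : Measurable fun p : Set.Iic i × Ω ↦ ⌊(p.1 : ℝ≥0) / δ⌋₊ :=
      Nat.measurable_floor.comp ((measurable_subtype_coe.comp measurable_fst).div_const δ)
    refine measurable_pi_iff.2 fun j ↦ ?_
    simp only [gridControl]
    refine Measurable.add (Finset.measurable_fun_sum _ fun l _ ↦ ?_) ?_
    · by_cases h : (l : ℝ≥0) * δ ≤ i
      · refine Measurable.ite (hfloor (measurableSet_singleton (l : ℕ))) ?_ measurable_const
        have h1 : Measurable fun v : GridValue m M ↦ ((v.1 j : ℕ) : ℝ) / M :=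
          measurable_of_countable _
        exact h1.comp (((ha l).mono (𝓕.mono h) le_rfl).comp measurable_snd)
      · have h0 : (fun p : Set.Iic i × Ω ↦
            if ⌊(p.1 : ℝ≥0) / δ⌋₊ = l then (((a l p.2).1 j : ℕ) : ℝ) / M else 0) = fun _ ↦ 0 := by
          ext p
          refine if_neg fun hp ↦ h ?_
          have h2 := Nat.floor_le (zero_le (a := (p.1 : ℝ≥0) / δ))
          rw [hp, le_div_iff₀ hδ] at h2
          exact h2.trans p.1.2
        rw [h0]
        exact measurable_const
    · exact Measurable.ite (hfloor measurableSet_Ici) measurable_const measurable_const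

theorem cumulative_gridControl_step {a : Fin N → Ω → GridValue m M} (hδ : 0 < δ)
    (ha : ∀ l : Fin N, Measurable[𝓕 (l * δ)] (a l)) (l : Fin N) (j : Fin m) (ω : Ω) :
    cumulative (fun t ω ↦ gridControl δ (fun l ↦ a l ω) t) j ((l + 1 : ℕ) * δ) ω
      - cumulative (fun t ω ↦ gridControl δ (fun l ↦ a l ω) t) j (l * δ) ω
      = δ * (((a l ω).1 j : ℝ) / M) := by
  rw [(isAdmissible_gridControl hδ ha).cumulative_sub, intervalIntegral.integral_of_le
    (by push_cast; nlinarith [δ.coe_nonneg]), integral_Ioc_eq_integral_Ioo]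
  have : Set.EqOn (fun r : ℝ ↦ gridControl δ (fun l ↦ a l ω) r.toNNReal j)
      (fun _ ↦ ((a l ω).1 j : ℝ) / M)
      (Set.Ioo ((l * δ : ℝ≥0) : ℝ) (((l + 1 : ℕ) * δ : ℝ≥0) : ℝ)) := by
    intro r hr
    refine gridControl_of_floor_eq (l := l) ?_ j
    have h1 : (l : ℝ≥0) * δ ≤ r.toNNReal := NNReal.le_toNNReal_of_coe_le hr.1.le
    have h2 : r.toNNReal < (l + 1 : ℕ) * δ :=
      (Real.toNNReal_lt_iff_lt_coe ((NNReal.coe_nonneg _).trans hr.1.le)).2 hr.2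
    rw [Nat.floor_eq_iff zero_le, le_div_iff₀ hδ, div_lt_iff₀ hδ]
    exact ⟨h1, by exact_mod_cast h2⟩
  rw [setIntegral_congr_fun measurableSet_Ioo this]
  simp
  ring_nf
  simp [δ.coe_nonneg]

theorem IsAdmissible.cumulative_add_of_eq_const {Φ : ℝ≥0 → Ω → Fin m → ℝ}
    (h : IsAdmissible 𝓕 Φ) {T : ℝ≥0} {j : Fin m} {ω : Ω} {c : ℝ} (hc : ∀ t, T ≤ t → Φ t ω j = c)
    (s : ℝ≥0) : cumulative Φ j (T + s) ω - cumulative Φ j T ω = c * s := by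
  rw [h.cumulative_sub]
  have : Set.EqOn (fun r : ℝ ↦ Φ r.toNNReal ω j) (fun _ ↦ c)
      (Set.uIcc (T : ℝ) ((T + s : ℝ≥0) : ℝ)) := by
    intro r hr
    rw [Set.uIcc_of_le (by push_cast; linarith [s.coe_nonneg])] at hr
    exact hc _ (NNReal.le_toNNReal_of_coe_le hr.1)
  rw [intervalIntegral.integral_congr this]
  simp
  ring

/-- Every admissible control is dominated, up to a small deterministic error in the cumulative
drift, by a control which is piecewise constant with values on a finite grid. -/
theorem IsAdmissible.exists_gridControl {Φ : ℝ≥0 → Ω → Fin m → ℝ} (h : IsAdmissible 𝓕 Φ)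
    (hδ : 0 < δ) (hM : 0 < M) (N : ℕ) :
    ∃ a : Fin N → Ω → GridValue m M, (∀ l : Fin N, Measurable[𝓕 (l * δ)] (a l)) ∧
      ∀ ω j, ∀ t ≤ N * δ, cumulative Φ j t ω - (2 * δ + N * δ / M)
        ≤ cumulative (fun t ω ↦ gridControl δ (fun l ↦ a l ω) t) j t ω := by
  have hδ' : (0 : ℝ) < δ := hδ
  have hM' : (0 : ℝ) < M := by exact_mod_cast hM
  -- The drift spent on the preceding grid interval is already known at `k * δ`; copying it with one
  -- step of delay keeps the new control adapted. For `k = 0` truncated subtraction makes it zero.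
  let d : ℕ → Fin m → Ω → ℝ := fun k j ω ↦
    cumulative Φ j (k * δ) ω - cumulative Φ j ((k - 1 : ℕ) * δ) ω
  have hpred (k : ℕ) : ((k - 1 : ℕ) : ℝ≥0) * δ ≤ k * δ := by
    gcongr; exact Nat.sub_le k 1
  have hd0 (k j ω) : 0 ≤ d k j ω := sub_nonneg.2 (h.cumulative_mono (hpred k) ω)
  have hdsum (k ω) : ∑ j, d k j ω ≤ δ := by
    refine (h.sum_cumulative_sub_le (hpred k) ω).trans ?_
    rcases k with _ | k
    · simp
    · rw [Nat.add_sub_cancel]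
      push_cast
      linarith
  -- Rounding down preserves the constraint on the sum and loses at most `δ / M` of drift per step,
  -- whence `N * δ / M` in the error; the delay accounts for `2 * δ`.
  let v : ℕ → Fin m → Ω → ℕ := fun k j ω ↦ ⌊M * d k j ω / δ⌋₊
  have hv (k j ω) : (v k j ω : ℝ) ≤ M * d k j ω / δ :=
    Nat.floor_le (by have := hd0 k j ω; positivity)
  have hvsum (k ω) : ∑ j, v k j ω ≤ M := by
    have h1 : ∑ j, (v k j ω : ℝ) ≤ M := by
      calc ∑ j, (v k j ω : ℝ) ≤ ∑ j, M * d k j ω / δ := Finset.sum_le_sum fun j _ ↦ hv k j ω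
        _ = M * (∑ j, d k j ω) / δ := by rw [Finset.mul_sum, Finset.sum_div]
        _ ≤ M * δ / δ := by gcongr; exact hdsum k ω
        _ = M := by field_simp
    exact_mod_cast h1
  have hvM (k j ω) : v k j ω < M + 1 :=
    Nat.lt_succ_of_le ((Finset.single_le_sum (f := fun j ↦ v k j ω) (fun _ _ ↦ Nat.zero_le _)
      (Finset.mem_univ j)).trans (hvsum k ω))
  let a : Fin N → Ω → GridValue m M := fun l ω ↦ ⟨fun j ↦ ⟨v l j ω, hvM l j ω⟩, hvsum l ω⟩
  have hvm (k : ℕ) (j : Fin m) : Measurable[𝓕 (k * δ)] (v k j) := by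
    refine Nat.measurable_floor.comp (Measurable.div_const (Measurable.const_mul
      (Measurable.sub (m := 𝓕 (k * δ)) (f := cumulative Φ j (k * δ))
        (g := cumulative Φ j ((k - 1 : ℕ) * δ)) (h.measurable_cumulative _) ?_) _) _)
    exact (h.measurable_cumulative _).mono (𝓕.mono (hpred k)) le_rfl
  have ham (l : Fin N) : Measurable[𝓕 (l * δ)] (a l) := by
    refine Measurable.subtype_mk ((@measurable_pi_iff _ _ _ (𝓕 (l * δ)) _ _).2 fun j ↦ ?_)
    have h1 : (fun ω ↦ (⟨v l j ω, hvM l j ω⟩ : Fin (M + 1)))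
        = (fun n : ℕ ↦ Fin.ofNat (M + 1) n) ∘ v l j := by
      ext ω
      simp [Nat.mod_eq_of_lt (hvM l j ω)]
    rw [h1]
    exact (measurable_of_countable _).comp (hvm l j)
  refine ⟨a, ham, fun ω j t ht ↦ ?_⟩
  set J := fun t ↦ cumulative (fun t ω ↦ gridControl δ (fun l ↦ a l ω) t) j t ω with hJ
  have hgrid : ∀ k : ℕ, k ≤ N →
      cumulative Φ j ((k - 1 : ℕ) * δ) ω - k * δ / M ≤ J (k * δ) := by
    intro k
    induction k with
    | zero => intro _; simp [hJ, cumulative_zero]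
    | succ k ih =>
      intro hk
      have h1 := ih (Nat.le_of_succ_le hk)
      have h2 := cumulative_gridControl_step hδ ham ⟨k, hk⟩ j ω
      have h3 : M * d k j ω / δ < v k j ω + 1 := Nat.lt_floor_add_one _
      have h4 : δ * ((v k j ω : ℝ) / M) ≥ d k j ω - δ / M := by
        rw [div_lt_iff₀ hδ'] at h3
        rw [ge_iff_le, sub_le_iff_le_add, ← mul_div_assoc, ← add_div, le_div_iff₀ hM']
        linarith
      have h5 : d k j ω = cumulative Φ j (k * δ) ω - cumulative Φ j ((k - 1 : ℕ) * δ) ω := rfl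
      simp only [a] at h2
      simp only [hJ, Nat.add_sub_cancel] at h1 ⊢
      have h6 : ((k + 1 : ℕ) : ℝ) * δ / M = k * δ / M + δ / M := by push_cast; ring
      rw [h6]
      linarith
  set k := ⌊t / δ⌋₊ with hk
  have hkt : (k : ℝ≥0) * δ ≤ t := by
    rw [← le_div_iff₀ hδ]; exact Nat.floor_le zero_le
  have hkt' : t < (k + 1 : ℕ) * δ := by
    rw [← div_lt_iff₀ hδ]; exact_mod_cast Nat.lt_floor_add_one (t / δ)
  have hkN : k ≤ N := by
    refine Nat.floor_le_of_le ?_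
    rwa [div_le_iff₀ hδ]
  have h1 := hgrid k hkN
  have h2 : J (k * δ) ≤ J t := (isAdmissible_gridControl hδ ham).cumulative_mono hkt ω
  have h3 := h.cumulative_sub_le (j := j) ((hpred k).trans hkt) ω
  have h4 : (k : ℝ) * δ / M ≤ N * δ / M := by gcongr
  have h5 : (t : ℝ) - ((k - 1 : ℕ) * δ : ℝ≥0) ≤ 2 * δ := by
    have : (t : ℝ) < ((k + 1 : ℕ) * δ : ℝ≥0) := by exact_mod_cast hkt'
    rcases k with _ | k
    · simp at this ⊢; linarith
    · rw [Nat.add_sub_cancel]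
      push_cast at this ⊢
      linarith
  linarith

end Grid

/-! ### Imitating a control on another Brownian basis. -/

section Transfer

variable {Ω : Type*} {mΩ : MeasurableSpace Ω} {P : Measure Ω} {𝓕 : Filtration ℝ≥0 mΩ}
  {W W' : ℕ → ℝ≥0 → Ω → ℝ} {b : ℝ} {m : ℕ} {Φ : ℝ≥0 → Ω → Fin m → ℝ} {x : Fin m → ℝ}
  {g : (Fin m → ℝ) → ℝ}

/-- The event that the `j`-th coordinate survives forever. -/
def surviveEvent (W : ℕ → ℝ≥0 → Ω → ℝ) (b : ℝ) (Φ : ℝ≥0 → Ω → Fin m → ℝ) (x : Fin m → ℝ)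
    (j : Fin m) : Set Ω :=
  {ω | ∀ t, 0 < controlledProcess W b Φ x j t ω}

/-- The event that the `j`-th coordinate stays above `η` until time `T`, where it exceeds `K`. -/
def aboveEvent (W : ℕ → ℝ≥0 → Ω → ℝ) (b : ℝ) (Φ : ℝ≥0 → Ω → Fin m → ℝ) (x : Fin m → ℝ)
    (T : ℝ≥0) (η K : ℝ) (j : Fin m) : Set Ω :=
  {ω | StaysAbove (fun t ↦ controlledProcess W b Φ x j t ω) T η ∧
    K ≤ controlledProcess W b Φ x j T ω}

theorem survival_eq_indicator_surviveEvent (j : Fin m) :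
    survival W b Φ x j = (surviveEvent W b Φ x j).indicator 1 :=
  survival_eq_indicator

namespace IsAdmissible

theorem nullMeasurableSet_surviveEvent (h : IsAdmissible 𝓕 Φ) (hW : IsBrownianBasis 𝓕 W P)
    (j : Fin m) : NullMeasurableSet (surviveEvent W b Φ x j) P :=
  h.nullMeasurableSet_survive hW

theorem measurableSet_aboveEvent (h : IsAdmissible 𝓕 Φ) (hW : IsBrownianBasis 𝓕 W P)
    (T : ℝ≥0) (η K : ℝ) (j : Fin m) : MeasurableSet (aboveEvent W b Φ x T η K j) :=
  (h.measurableSet_staysAbove hW T η).inter (measurableSet_le measurable_const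
    ((h.measurable_controlled hW T).mono (𝓕.le T) le_rfl))

/-- A coordinate which is at a high level `K` at time `T` and receives a positive drift `c`
from then on is likely to survive. -/
theorem real_aboveEvent_diff_surviveEvent_le [IsProbabilityMeasure P] (h : IsAdmissible 𝓕 Φ)
    (hW : IsBrownianBasis 𝓕 W P) (hb : 0 ≤ b) {T : ℝ≥0} {c : ℝ} (hc : 0 < c) {j : Fin m}
    (hΦ : ∀ t ω, T ≤ t → Φ t ω j = c) {η : ℝ} (hη : 0 < η) (K : ℝ) :
    P.real (aboveEvent W b Φ x T η K j \ surviveEvent W b Φ x j)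
      ≤ Real.exp (-(2 * c * (K - 1))) := by
  refine le_trans (ENNReal.toReal_mono (measure_ne_top P _) (measure_mono_ae ?_))
    (hW.real_exists_add_increment_nonpos_le j T hc K)
  filter_upwards [h.ae_continuous_controlled (b := b) (x := x) (j := j) hW] with ω hω
  rintro ⟨⟨h1, h2⟩, h3⟩
  simp only [surviveEvent, Set.mem_ofPred_eq, not_forall, not_lt] at h3
  obtain ⟨t, ht⟩ := h3
  -- Before `T` the path is at least `η > 0`, so ruin can only come later, where the drift is at
  -- least `c` because `b ≥ 0`.
  have htT : T ≤ t := by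
    by_contra hlt
    have := (staysAbove_iff hω).1 h1 t (not_le.1 hlt).le
    linarith
  refine ⟨t - T, ?_⟩
  rw [add_tsub_cancel_of_le htT]
  have h4 := h.cumulative_add_of_eq_const (fun t ht ↦ hΦ t ω ht) (t - T)
  rw [add_tsub_cancel_of_le htT] at h4
  rw [h.controlledProcess_eq] at h2 ht
  have h5 : b * T ≤ b * t := mul_le_mul_of_nonneg_left (by exact_mod_cast htT) hb
  linarith

end IsAdmissible

/-- For controls on a grid, the performance over a finite horizon does not depend on the Brownian
basis. -/
theorem IsSurvivalPayoff.exists_gridControl_integral_le [IsProbabilityMeasure P]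
    (hg : IsSurvivalPayoff g) (hW : IsBrownianBasis 𝓕 W P) (hW' : IsBrownianBasis 𝓕 W' P)
    {N M : ℕ} {δ : ℝ≥0} (hδ : 0 < δ) {a : Fin N → Ω → GridValue m M}
    (ha : ∀ l : Fin N, Measurable[𝓕 (l * δ)] (a l)) (η K : ℝ) :
    ∃ a' : Fin N → Ω → GridValue m M, (∀ l : Fin N, Measurable[𝓕 (l * δ)] (a' l)) ∧
      ∫ ω, g (fun j ↦ (aboveEvent W b (fun t ω ↦ gridControl δ (fun l ↦ a l ω) t) x (N * δ) η K
          j).indicator 1 ω) ∂P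
        ≤ ∫ ω, g (fun j ↦ (aboveEvent W' b (fun t ω ↦ gridControl δ (fun l ↦ a' l ω) t) x (N * δ)
          η K j).indicator 1 ω) ∂P := by
  set T : ℝ≥0 := N * δ with hT
  -- The controlled path as a function of grid choices and driving paths. With `Unit` as sample
  -- space, its accumulated drift depends on finitely many choices only, so measurability in them is
  -- automatic.
  let Y : Fin m → ℝ≥0 → (Fin N → GridValue m M) × (ℕ × ℝ≥0 → ℝ) → ℝ := fun j t q ↦
    x j + b * t + cumulative (fun t (_ : Unit) ↦ gridControl δ q.1 t) j t () + q.2 (j, t)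
  let D : Fin m → Set ((Fin N → GridValue m M) × (ℕ × ℝ≥0 → ℝ)) := fun j ↦
    {q | StaysAbove (fun t ↦ Y j t q) T η ∧ K ≤ Y j T q}
  have hY (j t) : Measurable (Y j t) := by
    refine Measurable.add (Measurable.add measurable_const ?_)
      ((measurable_pi_apply _).comp measurable_snd)
    exact (measurable_of_countable fun h : Fin N → GridValue m M ↦
      cumulative (fun t (_ : Unit) ↦ gridControl δ h t) j t ()).comp measurable_fst
  have hD (j) : MeasurableSet (D j) := by
    have h1 : MeasurableSet {q | StaysAbove (fun t ↦ Y j t q) T η} := by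
      simp only [StaysAbove, Set.ofPred_forall]
      exact MeasurableSet.iInter fun k ↦ measurableSet_le measurable_const (hY j _)
    exact h1.inter (measurableSet_le measurable_const (hY j T))
  let F : (Fin N → GridValue m M) × (ℕ × ℝ≥0 → ℝ) → ENNReal := fun q ↦
    ENNReal.ofReal (g fun j ↦ (D j).indicator 1 q)
  have hF : Measurable F :=
    ENNReal.measurable_ofReal.comp (hg.measurable.comp (measurable_pi_iff.2 fun j ↦
      measurable_one.indicator (hD j)))
  have hFeq {W : ℕ → ℝ≥0 → Ω → ℝ} {a : Fin N → Ω → GridValue m M}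
      (ha : ∀ l : Fin N, Measurable[𝓕 (l * δ)] (a l)) (ω : Ω) :
      F (fun l ↦ a l ω, stoppedPath W T ω) = ENNReal.ofReal (g (fun j ↦ (aboveEvent W b
        (fun t ω ↦ gridControl δ (fun l ↦ a l ω) t) x T η K j).indicator 1 ω)) := by
    simp only [F]
    congr 2
    ext j
    have hmem : (fun l ↦ a l ω, stoppedPath W T ω) ∈ D j ↔ ω ∈ aboveEvent W b
        (fun t ω ↦ gridControl δ (fun l ↦ a l ω) t) x T η K j := by
      simp only [D, aboveEvent, StaysAbove, Set.mem_ofPred_eq, Y, stoppedPath,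
        (isAdmissible_gridControl hδ ha).controlledProcess_eq, min_self, min_assoc]
      rfl
    by_cases hω : ω ∈ aboveEvent W b (fun t ω ↦ gridControl δ (fun l ↦ a l ω) t) x T η K j
    · rw [Set.indicator_of_mem hω, Set.indicator_of_mem (hmem.2 hω)]; rfl
    · rw [Set.indicator_of_notMem hω, Set.indicator_of_notMem (mt hmem.1 hω)]
  obtain ⟨a', ha', hle⟩ := hW.exists_adapted_lintegral_le hW' δ a ha hF
  refine ⟨a', ha', ?_⟩
  rw [← hT] at hle
  simp only [hFeq ha, hFeq ha'] at hle
  have hnn (A : Fin m → Set Ω) (ω : Ω) : 0 ≤ g fun j ↦ (A j).indicator 1 ω :=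
    hg.nonneg _ fun j ↦ indicator_one_eq_zero_or_one _ ω
  rw [← ofReal_integral_eq_lintegral_ofReal (hg.integrable fun j ↦
      ((isAdmissible_gridControl hδ ha).measurableSet_aboveEvent hW T η K j).nullMeasurableSet)
      (ae_of_all _ fun ω ↦ hnn _ ω),
    ← ofReal_integral_eq_lintegral_ofReal (hg.integrable fun j ↦
      ((isAdmissible_gridControl hδ ha').measurableSet_aboveEvent hW' T η K j).nullMeasurableSet)
      (ae_of_all _ fun ω ↦ hnn _ ω),
    ENNReal.ofReal_le_ofReal_iff (integral_nonneg fun ω ↦ hnn _ ω)] at hle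
  exact hle

/-- For nonnegative base drift, every control can be matched, up to an arbitrarily small loss, by a
control for another Brownian basis which eventually gives everyone the drift `1 / (m + 1)`. -/
theorem IsAdmissible.exists_integral_survival_le [IsProbabilityMeasure P] (h : IsAdmissible 𝓕 Φ)
    (hg : IsSurvivalPayoff g) (hW : IsBrownianBasis 𝓕 W P) (hW' : IsBrownianBasis 𝓕 W' P)
    (hb : 0 ≤ b) {ε : ℝ} (hε : 0 < ε) :
    ∃ (Φ' : ℝ≥0 → Ω → Fin m → ℝ) (T : ℝ≥0), IsAdmissible 𝓕 Φ' ∧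
      (∀ t ω j, T ≤ t → Φ' t ω j = 1 / ((m : ℝ) + 1)) ∧
      ∫ ω, g (fun j ↦ survival W b Φ x j ω) ∂P
        ≤ ∫ ω, g (fun j ↦ survival W' b Φ' x j ω) ∂P + ε := by
  set c : ℝ := 1 / ((m : ℝ) + 1) with hc
  have hc0 : 0 < c := by positivity
  -- Each agent costs three errors: being low at `T`, coming close to zero before `T`, and ruin
  -- after `T`. The parameters are then fixed in the order `K`, `T`, `η`, `R`.
  set ε' : ℝ := ε / (3 * ((m : ℝ) + 1)) with hε'
  have hε'0 : 0 < ε' := by positivity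
  obtain ⟨K, hK⟩ : ∃ K : ℝ, Real.exp (-(2 * c * (K - 1))) ≤ ε' := by
    have : Tendsto (fun K : ℝ ↦ Real.exp (-(2 * c * (K - 1)))) atTop (𝓝 0) := by
      refine Real.tendsto_exp_neg_atTop_nhds_zero.comp ?_
      exact (tendsto_atTop_add_const_right _ (-1) tendsto_id).const_mul_atTop (by positivity)
    exact (this.eventually_le_const hε'0).exists
  obtain ⟨T, hT, hT0⟩ := ((eventually_all.2 fun j ↦
    h.eventually_real_survive_and_lt (b := b) (x := x) hW j (K + 1) hε'0).and
      (eventually_gt_atTop 0)).exists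
  obtain ⟨k, hk⟩ := (eventually_all.2 fun j ↦
    h.exists_real_survive_and_not_staysAbove (b := b) (x := x) hW j T hε'0).exists
  set η : ℝ := 1 / (k + 1) with hη
  have hη0 : 0 < η := by positivity
  have hη1 : η ≤ 1 := by
    rw [hη, div_le_one (by positivity)]
    linarith [k.cast_nonneg (α := ℝ)]
  -- `R` is both the number of time steps and the number of shares. With `δ = T / R` the grid error
  -- `2 δ + R δ / R` is `3 T / R`.
  obtain ⟨R, hR, hR0⟩ : ∃ R : ℕ, 3 * (T : ℝ) / R ≤ η / 2 ∧ 0 < R := by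
    have : Tendsto (fun R : ℕ ↦ 3 * (T : ℝ) / R) atTop (𝓝 0) :=
      tendsto_const_div_atTop_nhds_zero_nat _
    exact ((this.eventually_le_const (half_pos hη0)).and (eventually_gt_atTop 0)).exists
  have hR0' : (0 : ℝ≥0) < R := by exact_mod_cast hR0
  set δ : ℝ≥0 := T / R with hδ
  have hδ0 : 0 < δ := div_pos (by exact_mod_cast hT0) hR0'
  have hRδ : (R : ℝ≥0) * δ = T := mul_div_cancel₀ _ hR0'.ne'
  obtain ⟨a, ha, hle⟩ := h.exists_gridControl hδ0 hR0 R
  obtain ⟨a', ha', hint⟩ := hg.exists_gridControl_integral_le (b := b) (x := x) hW hW' hδ0 ha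
    (η / 2) K
  rw [hRδ] at hle hint
  have hadm := isAdmissible_gridControl hδ0 ha
  have hadm' := isAdmissible_gridControl hδ0 ha'
  set Ψ : ℝ≥0 → Ω → Fin m → ℝ := fun t ω ↦ gridControl δ (fun l ↦ a l ω) t with hΨ
  set Φ' : ℝ≥0 → Ω → Fin m → ℝ := fun t ω ↦ gridControl δ (fun l ↦ a' l ω) t with hΦ'
  have htail : ∀ t ω j, (T : ℝ≥0) ≤ t → Φ' t ω j = c := fun t ω j ht ↦ by
    refine gridControl_of_le_floor (Nat.le_floor ?_) j
    rwa [le_div_iff₀ hδ0, hRδ]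
  refine ⟨Φ', T, hadm', htail, ?_⟩
  simp only [survival_eq_indicator_surviveEvent]
  -- The grid costs at most `η / 2` in height, which the slack between `η` and `η / 2`, and between
  -- `K + 1` and `K`, absorbs.
  have hsub : ∀ j, aboveEvent W b Φ x T η (K + 1) j \ aboveEvent W b Ψ x T (η / 2) K j = ∅ := by
    intro j
    rw [Set.sdiff_eq_empty]
    have hcmp : ∀ ω, ∀ t ≤ (T : ℝ≥0), controlledProcess W b Φ x j t ω - η / 2
        ≤ controlledProcess W b Ψ x j t ω := by
      intro ω t ht
      have h1 := hle ω j t ht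
      have h2 : 2 * (δ : ℝ) + R * δ / R = 3 * T / R := by
        rw [hδ]
        push_cast
        have : (R : ℝ) ≠ 0 := by positivity
        field_simp
        ring
      rw [h2] at h1
      rw [h.controlledProcess_eq, hadm.controlledProcess_eq]
      linarith
    rintro ω ⟨h1, h2⟩
    refine ⟨fun i ↦ ?_, ?_⟩
    · have h3 := hcmp ω _ (min_le_right (TopologicalSpace.denseSeq ℝ≥0 i) T)
      have h4 := h1 i
      simp only at h4 ⊢
      linarith
    · have h3 := hcmp ω T le_rfl
      linarith
  have hE := fun j ↦ (h.measurableSet_aboveEvent (b := b) (x := x) hW T η (K + 1)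
    j).nullMeasurableSet (μ := P)
  have hE1 := fun j ↦ (hadm.measurableSet_aboveEvent (b := b) (x := x) hW T (η / 2) K
    j).nullMeasurableSet (μ := P)
  have hE2 := fun j ↦ (hadm'.measurableSet_aboveEvent (b := b) (x := x) hW' T (η / 2) K
    j).nullMeasurableSet (μ := P)
  have step1 := hg.integral_le (fun j ↦ h.nullMeasurableSet_surviveEvent (b := b) (x := x) hW j) hE
  have step2 := hg.integral_le hE hE1
  have step4 := hg.integral_le hE2
    (fun j ↦ hadm'.nullMeasurableSet_surviveEvent (b := b) (x := x) hW' j)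
  simp only [hsub, measureReal_empty, Finset.sum_const_zero, add_zero] at step2
  have hs1 : ∑ j, P.real (surviveEvent W b Φ x j \ aboveEvent W b Φ x T η (K + 1) j)
      ≤ ∑ j : Fin m, 2 * ε' := by
    refine Finset.sum_le_sum fun j _ ↦ ?_
    refine (measureReal_mono (s₂ := {ω | (∀ t, 0 < controlledProcess W b Φ x j t ω) ∧
      controlledProcess W b Φ x j T ω < K + 1} ∪ {ω | (∀ t, 0 < controlledProcess W b Φ x j t ω) ∧
      ¬ StaysAbove (fun t ↦ controlledProcess W b Φ x j t ω) T (1 / (k + 1))}) ?_).trans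
      ((measureReal_union_le _ _).trans ?_)
    · rintro ω ⟨h1, h2⟩
      by_cases h3 : StaysAbove (fun t ↦ controlledProcess W b Φ x j t ω) T η
      · exact Or.inl ⟨h1, not_le.1 fun h4 ↦ h2 ⟨h3, h4⟩⟩
      · exact Or.inr ⟨h1, h3⟩
    · linarith [hT j, hk j]
  have hs4 : ∑ j, P.real (aboveEvent W' b Φ' x T (η / 2) K j \ surviveEvent W' b Φ' x j)
      ≤ ∑ j : Fin m, ε' :=
    Finset.sum_le_sum fun j _ ↦ (hadm'.real_aboveEvent_diff_surviveEvent_le hW' hb hc0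
      (fun t ω ht ↦ htail t ω j ht) (half_pos hη0) K).trans hK
  have hsum : ∑ j : Fin m, 2 * ε' + ∑ j : Fin m, ε' ≤ ε := by
    simp only [Finset.sum_const, Finset.card_univ, Fintype.card_fin, nsmul_eq_mul]
    have : ε = 3 * ((m : ℝ) + 1) * ε' := by rw [hε']; field_simp
    nlinarith
  linarith

end Transfer

/-! ### Adding and removing the distant agent. -/

section Limit

variable {Ω : Type*} {mΩ : MeasurableSpace Ω} {P : Measure Ω} {𝓕 : Filtration ℝ≥0 mΩ}
  {W : ℕ → ℝ≥0 → Ω → ℝ} {b : ℝ} {m : ℕ} {Φ : ℝ≥0 → Ω → Fin m → ℝ} {x : Fin m → ℝ}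
  {g : (Fin m → ℝ) → ℝ}

/-- The increasing enumeration of the natural numbers other than `i`. -/
def skip (i k : ℕ) : ℕ := if k < i then k else k + 1

theorem skip_injective (i : ℕ) : Function.Injective (skip i) := by
  intro k l h
  simp only [skip] at h
  split_ifs at h <;> omega

theorem skip_eq_succAbove (i : Fin (m + 1)) (j : Fin m) : skip i j = (i.succAbove j : ℕ) := by
  rw [skip, Fin.succAbove]
  simp only [Fin.lt_def, Fin.val_castSucc]
  split_ifs <;> rfl

theorem IsBrownianBasis.reindex (hW : IsBrownianBasis 𝓕 W P) {e : ℕ → ℕ}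
    (he : Function.Injective e) : IsBrownianBasis 𝓕 (fun k ↦ W (e k)) P where
  rightContinuous := hW.rightContinuous
  complete := hW.complete
  brownian k := hW.brownian (e k)
  indep := hW.indep.precomp he
  adapted k := hW.adapted (e k)
  indep_increments s := by
    refine indep_of_indep_of_le_left (hW.indep_increments s) ?_
    rw [← measurable_iff_comap_le]
    have hu : Measurable fun (w : ℕ × ℝ≥0 → ℝ) (p : ℕ × ℝ≥0) ↦ w (e p.1, p.2) :=
      measurable_pi_iff.2 fun p ↦ measurable_pi_apply _
    exact hu.comp (comap_measurable
      (fun ω (p : ℕ × ℝ≥0) ↦ W p.1 (s + p.2) ω - W p.1 s ω))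

/-- Adding an agent in position `i`, who only receives the drift `1 / (m + 1)` from time `T` on. -/
noncomputable def extendControl (i : Fin (m + 1)) (T : ℝ≥0) (Φ : ℝ≥0 → Ω → Fin m → ℝ)
    (t : ℝ≥0) (ω : Ω) : Fin (m + 1) → ℝ :=
  i.insertNth (if T ≤ t then 1 / ((m : ℝ) + 1) else 0) (Φ t ω)

theorem IsAdmissible.extend (h : IsAdmissible 𝓕 Φ) (i : Fin (m + 1)) {T : ℝ≥0}
    (hT : ∀ t ω j, T ≤ t → Φ t ω j = 1 / ((m : ℝ) + 1)) :
    IsAdmissible 𝓕 (extendControl i T Φ) where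
  progressive s := by
    let m₀ : MeasurableSpace (Set.Iic s × Ω) := Subtype.instMeasurableSpace.prod (𝓕 s)
    refine measurable_pi_iff.2 fun j ↦ ?_
    induction j using Fin.succAboveCases i with
    | x =>
      simp only [extendControl, Fin.insertNth_apply_same]
      exact Measurable.ite (measurableSet_le measurable_const
        (measurable_subtype_coe.comp measurable_fst)) measurable_const measurable_const
    | p j =>
      simp only [extendControl, Fin.insertNth_apply_succAbove]
      exact (measurable_pi_apply j).comp (h.progressive s)
  mem_Icc t ω j := by
    induction j using Fin.succAboveCases i with
    | x =>
      simp only [extendControl, Fin.insertNth_apply_same]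
      split_ifs
      · exact ⟨by positivity, div_le_one_of_le₀ (by linarith [m.cast_nonneg (α := ℝ)])
          (by positivity)⟩
      · simp
    | p j => simpa only [extendControl, Fin.insertNth_apply_succAbove] using h.mem_Icc t ω j
  sum_le_one t ω := by
    rw [Fin.sum_univ_succAbove _ i]
    simp only [extendControl, Fin.insertNth_apply_same, Fin.insertNth_apply_succAbove]
    split_ifs with ht
    · simp only [hT t ω _ ht, Finset.sum_const, Finset.card_univ, Fintype.card_fin, nsmul_eq_mul]
      refine le_of_eq ?_
      field_simp
      ring
    · simpa using h.sum_le_one t ω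

theorem IsAdmissible.removeAgent {Ψ : ℝ≥0 → Ω → Fin (m + 1) → ℝ} (h : IsAdmissible 𝓕 Ψ)
    (i : Fin (m + 1)) : IsAdmissible 𝓕 fun t ω j ↦ Ψ t ω (i.succAbove j) where
  progressive s := (@measurable_pi_iff _ _ _ (Subtype.instMeasurableSpace.prod (𝓕 s)) _ _).2 fun j ↦
    (measurable_pi_apply (i.succAbove j)).comp (h.progressive s)
  mem_Icc t ω j := h.mem_Icc t ω _
  sum_le_one t ω := by
    have := h.sum_le_one t ω
    rw [Fin.sum_univ_succAbove _ i] at this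
    linarith [(h.mem_Icc t ω i).1]

/-- Deleting agent `i` leaves the same paths, driven by the basis that skips `i`; this is why the
value must not depend on the basis. -/
theorem surviveEvent_succAbove {Ψ : ℝ≥0 → Ω → Fin (m + 1) → ℝ} (i : Fin (m + 1)) (z : ℝ)
    (j : Fin m) : surviveEvent W b Ψ (i.insertNth z x) (i.succAbove j)
      = surviveEvent (fun k ↦ W (skip i k)) b (fun t ω j ↦ Ψ t ω (i.succAbove j)) x j := by
  simp only [surviveEvent, controlledProcess, skip_eq_succAbove, Fin.insertNth_apply_succAbove]

/-- The best expected payoff over all admissible controls. -/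
noncomputable def payoffValue (𝓕 : Filtration ℝ≥0 mΩ) (W : ℕ → ℝ≥0 → Ω → ℝ) (P : Measure Ω)
    (b : ℝ) (g : (Fin m → ℝ) → ℝ) (x : Fin m → ℝ) : ℝ :=
  ⨆ Φ : {Φ : ℝ≥0 → Ω → Fin m → ℝ // IsAdmissible 𝓕 Φ},
    ∫ ω, g (fun j ↦ survival W b Φ.1 x j ω) ∂P

instance : Nonempty {Φ : ℝ≥0 → Ω → Fin m → ℝ // IsAdmissible 𝓕 Φ} :=
  ⟨⟨fun _ _ _ ↦ 0, fun _ ↦ measurable_const, by simp, by simp⟩⟩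

variable [IsProbabilityMeasure P]

theorem IsSurvivalPayoff.integral_survival_le_payoffValue (hg : IsSurvivalPayoff g)
    (hW : IsBrownianBasis 𝓕 W P) (h : IsAdmissible 𝓕 Φ) :
    ∫ ω, g (fun j ↦ survival W b Φ x j ω) ∂P ≤ payoffValue 𝓕 W P b g x := by
  -- A real supremum needs an upper bound for the family; `g 0 + m` bounds every performance.
  refine le_ciSup (f := fun Φ : {Φ : ℝ≥0 → Ω → Fin m → ℝ // IsAdmissible 𝓕 Φ} ↦
    ∫ ω, g (fun j ↦ survival W b Φ.1 x j ω) ∂P) ⟨g 0 + m, ?_⟩ ⟨Φ, h⟩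
  rintro _ ⟨⟨Ψ, hΨ⟩, rfl⟩
  simp only [survival_eq_indicator_surviveEvent]
  calc _ ≤ ∫ ω, (g 0 + m) ∂P := integral_mono
        (hg.integrable fun j ↦ hΨ.nullMeasurableSet_surviveEvent hW j) (integrable_const _)
        fun ω ↦ hg.indicator_le _ ω
    _ = g 0 + m := by simp

/-- An agent who receives the drift `1 / (m + 1)` from time `T` on survives with high probability if
started far away. -/
theorem IsAdmissible.tendsto_real_compl_surviveEvent {Ψ : ℝ≥0 → Ω → Fin (m + 1) → ℝ}
    (h : IsAdmissible 𝓕 Ψ) (hW : IsBrownianBasis 𝓕 W P) (hb : 0 ≤ b) (i : Fin (m + 1)) {T : ℝ≥0}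
    {c : ℝ} (hc : 0 < c) (hT : ∀ t ω, T ≤ t → Ψ t ω i = c) :
    Tendsto (fun z ↦ P.real (surviveEvent W b Ψ (i.insertNth z x) i)ᶜ) atTop (𝓝 0) := by
  have hlim : Tendsto (fun z ↦ Real.exp (-(2 * c * (z - c * T - 1)))) atTop (𝓝 0) := by
    refine Real.tendsto_exp_neg_atTop_nhds_zero.comp ?_
    refine Tendsto.const_mul_atTop (by positivity) ?_
    exact tendsto_atTop_add_const_right _ (-1)
      (tendsto_atTop_add_const_right _ (-(c * T)) tendsto_id)
  refine squeeze_zero (fun z ↦ measureReal_nonneg) (fun z ↦ ?_) hlim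
  refine le_trans (ENNReal.toReal_mono (measure_ne_top P _) (measure_mono_ae ?_))
    (hW.real_exists_add_increment_nonpos_le i 0 hc (z - c * T))
  filter_upwards [(hW.brownian i).eval_zero_ae_eq_zero] with ω hω hmem
  change ¬ ∀ t, 0 < controlledProcess W b Ψ (i.insertNth z x) i t ω at hmem
  simp only [not_forall, not_lt] at hmem
  obtain ⟨t, ht⟩ := hmem
  refine ⟨t, ?_⟩
  rw [zero_add, hω, sub_zero]
  rw [h.controlledProcess_eq, Fin.insertNth_apply_same] at ht
  have hbt : 0 ≤ b * t := mul_nonneg hb t.coe_nonneg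
  -- The waiting time costs at most `c * T` of height, so the agent dominates a Brownian motion with
  -- drift `c` started at `z - c * T`.
  have hcum : c * (t - T) ≤ cumulative Ψ i t ω := by
    rcases le_total t T with h1 | h1
    · have h2 : (t : ℝ) - T ≤ 0 := sub_nonpos.2 (by exact_mod_cast h1)
      nlinarith [h.cumulative_nonneg (j := i) t ω]
    · have h2 := h.cumulative_add_of_eq_const (fun t ht ↦ hT t ω ht) (t - T)
      rw [add_tsub_cancel_of_le h1, NNReal.coe_sub h1] at h2
      linarith [h.cumulative_nonneg (j := i) T ω]
  nlinarith

/-- For a nonnegative base drift, an agent who starts far away survives at no cost for the others. -/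
theorem IsSurvivalPayoff.tendsto_payoffValue_insertNth (hg : IsSurvivalPayoff g)
    {g' : (Fin (m + 1) → ℝ) → ℝ} (hg' : IsSurvivalPayoff g') (i : Fin (m + 1)) {κ : ℝ}
    (hκ : ∀ u, g' (i.insertNth 1 u) = g u + κ) (hW : IsBrownianBasis 𝓕 W P) (hb : 0 ≤ b) :
    Tendsto (fun z : ℝ ↦ payoffValue 𝓕 W P b g' (i.insertNth z x)) atTop
      (𝓝 (payoffValue 𝓕 W P b g x + κ)) := by
  set W' : ℕ → ℝ≥0 → Ω → ℝ := fun k ↦ W (skip i k) with hW'def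
  have hW' : IsBrownianBasis 𝓕 W' P := hW.reindex (skip_injective i)
  have hsplit {A : Fin m → Set Ω} (hA : ∀ j, NullMeasurableSet (A j) P) :
      ∫ ω, g' (fun j ↦ Set.indicator ((i.insertNth Set.univ A : Fin (m + 1) → Set Ω) j) 1 ω) ∂P
        = ∫ ω, g (fun j ↦ (A j).indicator 1 ω) ∂P + κ := by
    have h1 (ω : Ω) : (fun j ↦ Set.indicator ((i.insertNth Set.univ A : Fin (m + 1) → Set Ω) j)
        (1 : Ω → ℝ) ω) = i.insertNth 1 fun j ↦ (A j).indicator 1 ω := by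
      ext j
      induction j using Fin.succAboveCases i with
      | x => simp
      | p j => simp
    simp only [h1, hκ]
    rw [integral_add (hg.integrable hA) (integrable_const _)]
    simp
  have hnull {A : Fin m → Set Ω} (hA : ∀ j, NullMeasurableSet (A j) P) (j : Fin (m + 1)) :
      NullMeasurableSet ((i.insertNth Set.univ A : Fin (m + 1) → Set Ω) j) P := by
    induction j using Fin.succAboveCases i with
    | x => simp
    | p j => simpa using hA j
  have hupper (z : ℝ) : payoffValue 𝓕 W P b g' (i.insertNth z x)
      ≤ payoffValue 𝓕 W P b g x + κ := by
    refine ciSup_le fun ⟨Ψ, hΨ⟩ ↦ le_of_forall_pos_le_add fun ε hε ↦ ?_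
    have hΦ := hΨ.removeAgent i
    obtain ⟨Φ', T, hΦ', -, hle⟩ := hΦ.exists_integral_survival_le (x := x) hg hW' hW hb hε
    have h1 := hg.integral_survival_le_payoffValue (b := b) (x := x) hW hΦ'
    have hA := fun j ↦ hΦ.nullMeasurableSet_surviveEvent (b := b) (x := x) hW' j
    -- Agent `i` is declared immortal. The events only grow, so every loss term is empty.
    have h2 := hg'.integral_le (fun j ↦ hΨ.nullMeasurableSet_surviveEvent (b := b)
      (x := i.insertNth z x) hW j) (hnull hA)
    rw [hsplit hA, Fin.sum_univ_succAbove _ i] at h2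
    simp only [Fin.insertNth_apply_same, Fin.insertNth_apply_succAbove, surviveEvent_succAbove,
      ← hW'def, sdiff_self, Set.bot_eq_empty, Set.sdiff_univ, measureReal_empty, Finset.sum_const_zero,
      add_zero] at h2
    simp only [survival_eq_indicator_surviveEvent] at hle h1 ⊢
    linarith
  have hlower {a : ℝ} (ha : a < payoffValue 𝓕 W P b g x + κ) :
      ∀ᶠ z in atTop, a < payoffValue 𝓕 W P b g' (i.insertNth z x) := by
    obtain ⟨⟨Φ, hΦ⟩, hlt⟩ := exists_lt_of_lt_ciSup (sub_lt_iff_lt_add.2 ha)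
    simp only at hlt
    set ε := (∫ ω, g (fun j ↦ survival W b Φ x j ω) ∂P - (a - κ)) / 2 with hε
    have hε0 : 0 < ε := by rw [hε]; linarith
    obtain ⟨Φ', T, hΦ', hT, hle⟩ := hΦ.exists_integral_survival_le (x := x) hg hW hW' hb hε0
    have hΨ := hΦ'.extend i hT
    have htail : ∀ t ω, T ≤ t → extendControl i T Φ' t ω i = 1 / ((m : ℝ) + 1) := by
      intro t ω ht
      simp [extendControl, ht]
    have hsmall := hΨ.tendsto_real_compl_surviveEvent (x := x) hW hb i
      (c := 1 / ((m : ℝ) + 1)) (by positivity) htail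
    filter_upwards [hsmall.eventually_lt_const hε0] with z hz
    refine lt_of_lt_of_le ?_ (hg'.integral_survival_le_payoffValue hW hΨ)
    have hA := fun j ↦ hΦ'.nullMeasurableSet_surviveEvent (b := b) (x := x) hW' j
    -- The other agents have the same survival events under both controls; the only loss is the ruin
    -- probability of agent `i`.
    have h2 := hg'.integral_le (hnull hA) (fun j ↦ hΨ.nullMeasurableSet_surviveEvent (b := b)
      (x := i.insertNth z x) hW j)
    have hre : (fun t ω j ↦ extendControl i T Φ' t ω (i.succAbove j)) = Φ' := by
      ext t ω j
      simp [extendControl]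
    rw [hsplit hA, Fin.sum_univ_succAbove _ i] at h2
    simp only [Fin.insertNth_apply_same, Fin.insertNth_apply_succAbove, surviveEvent_succAbove,
      hre, ← hW'def, sdiff_self, Set.bot_eq_empty, measureReal_empty, Finset.sum_const_zero,
      add_zero, ← Set.compl_eq_univ_sdiff] at h2
    simp only [survival_eq_indicator_surviveEvent] at hle hε ⊢
    linarith
  refine tendsto_order.2 ⟨fun a ha ↦ hlower ha, fun a ha ↦ ?_⟩
  exact Eventually.of_forall fun z ↦ (hupper z).trans_lt ha

end Limit

/-! ### The two limits. -/

theorem lemma1p4 {Ω : Type*} {mΩ : MeasurableSpace Ω} (P : Measure Ω) [IsProbabilityMeasure P]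
    (𝓕 : Filtration ℝ≥0 mΩ) (W : ℕ → ℝ≥0 → Ω → ℝ) (hW : IsBrownianBasis 𝓕 W P)
    (b : ℝ) (m : ℕ) (hm : 1 ≤ m) (i : Fin (m + 1))
    (x : Fin m → ℝ) (hx : ∀ j, 0 ≤ x j) :
    ((0 ≤ b ∨ b ≤ -1 / (m : ℝ)) →
      Tendsto (fun z : ℝ ↦ valueV 𝓕 W P b (m + 1) (i.insertNth z x)) atTop
        (𝓝 (valueV 𝓕 W P b m x))) ∧
    (0 ≤ b →
      Tendsto (fun z : ℝ ↦ valueU 𝓕 W P b (m + 1) (i.insertNth z x)) atTop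
        (𝓝 (valueU 𝓕 W P b m x + 1))) := by
  refine ⟨fun hb ↦ ?_, fun hb ↦ ?_⟩
  · rcases hb with hb | hb
    · have := (isSurvivalPayoff_prod m).tendsto_payoffValue_insertNth (x := x) (κ := 0)
        (isSurvivalPayoff_prod (m + 1)) i
        (fun u ↦ by rw [Fin.prod_univ_succAbove _ i]; simp) hW hb
      simpa only [payoffValue, valueV, add_zero] using this
    · have hm0 : (0 : ℝ) < m := by exact_mod_cast hm
      have h1 : (m : ℝ) * b + 1 ≤ 0 := by
        rw [le_div_iff₀ hm0] at hb
        linarith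
      -- Since `b ≤ 0`, one more agent keeps the total drift nonpositive, so both values are zero.
      have hb0 : b ≤ 0 := by nlinarith
      have h2 : ((m + 1 : ℕ) : ℝ) * b + 1 ≤ 0 := by push_cast; linarith
      simp only [valueV_eq_zero hW hm h1, valueV_eq_zero hW (Nat.le_add_left 1 m) h2]
      exact tendsto_const_nhds
  · have := (isSurvivalPayoff_sum m).tendsto_payoffValue_insertNth (x := x) (κ := 1)
      (isSurvivalPayoff_sum (m + 1)) i
      (fun u ↦ by rw [Fin.sum_univ_succAbove _ i]; simp [add_comm]) hW hb
    simpa only [payoffValue, valueU] using this
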